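/- Let $p_+,p_-\ge 2$ be coprime integers and put $$\alpha_+=\sqrt{2p_- /p_+},\quad \alpha_-=-\sqrt{2p_+/p_-},\quad \alpha_0=\alpha_++\alpha_-,\quad \alpha=\sqrt{2p_+p_-},\quad c=1-3\alpha_0^2,$$ $$\alpha_{r,s;n}=\tfrac{1-r}{2}\alpha_++\tfrac{1-s}{2}\alpha_-+\tfrac n2\alpha\qquad(r,s,n\in\mathbb Z).$$ For $\lambda\in\mathbb C$ let $\mathcal F_\lambda$ be the Heisenberg Fock module of highest weight $\lambda$, with $L(0)=\frac12a_0^2-\frac{\alpha_0}2a_0+\sum_{m\ge1}a_{-m}a_m$ and character $\mathrm{ch}[\mathcal F_\lambda](\tau)=\mathrm{tr}_{\mathcal F_\lambda}q^{L(0)-c/24}$, $q=e^{2\pi i\tau}$, and let $\mathcal F_{r,s;n}=\mathcal F_{\alpha_{r,s;n}}$. **Regularised characters** ($\epsilon\in\mathbb C$). For standard modules, $$\mathrm{ch}[\mathcal F_\lambda^\epsilon]=e^{2\pi\epsilon(\lambda-\alpha_0/2)}\,\mathrm{ch}[\mathcal F_\lambda].$$ The characters of the Virasoro minimal model modules $\mathcal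 L_{r,s}$ ($1\le r<p_+$, $1\le s<p_-$), which are not regularised, are $$\mathrm{ch}[\mathcal L_{r,s}]=\sum_{k\in\mathbb Z}\big(\mathrm{ch}[\mathcal F_{r,s;2k}]-\mathrm{ch}[\mathcal F_{p_+-r,s;2k+1}]\big).$$ The regularised characters of the atypical modules $\mathcal I_{r,s;n}$ ($1\le r\le p_+$, $1\le s\le p_-$, $n\in\mathbb Z$) over the $(p_+,p_-)$-singlet vertex operator algebra are defined through their (co)resolutions by Fock modules: for $r<p_+$, $s<p_-$, $$\mathrm{ch}[\mathcal I_{r,s;n}^\epsilon]=V_{r,s;n}+\sum_{k\ge0}(k+1)\Big(\mathrm{ch}[\mathcal F^\epsilon_{p_+-r,s;n-2k-1}]+\mathrm{ch}[\mathcal F^\epsilon_{r,p_--s;n-2k-3}]-\mathrm{ch}[\mathcal F^\epsilon_{r,s;n-2k-2}]-\mathrm{ch}[\mathcal F^\epsilon_{p_+-r,p_--s;n-2k-2}]\Big),$$ where $V_{r,s;n}=0$ for $n<0$, $V_{r,s;n}=n\,\mathrm{ch}[\mathcal L_{r,s}]$ for even $n\ge0$ and $V_{r,s;n}=-n\,\mathrm{ch}[\mathcal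 L_{r,p_--s}]$ for odd $n\ge 0$; and on the border $$\mathrm{ch}[\mathcal I_{r,p_-;n}^\epsilon]=\sum_{k\ge0}\big(\mathrm{ch}[\mathcal F^\epsilon_{p_+-r,p_-;n-2k-1}]-\mathrm{ch}[\mathcal F^\epsilon_{r,p_-;n-2k-2}]\big)\quad(r<p_+),$$ $$\mathrm{ch}[\mathcal I_{p_+,s;n}^\epsilon]=\sum_{k\ge0}\big(\mathrm{ch}[\mathcal F^\epsilon_{p_+,s;n-2k}]-\mathrm{ch}[\mathcal F^\epsilon_{p_+,p_--s;n-2k-1}]\big)\quad(s<p_-),\qquad \mathcal I_{p_+,p_-;n}=\mathcal F_{p_+,p_-;n}.$$ The singlet algebra itself is $\mathcal K_{1,1;0}$, with $\mathrm{ch}[\mathcal K_{1,1;0}^\epsilon]=\mathrm{ch}[\mathcal L_{1,1}]+\mathrm{ch}[\mathcal I_{1,1;0}^\epsilon]$. The regularised quantum dimension of a module $M$ is $$\mathrm{qdim}[M^\epsilon]=\lim_{y\to0^+}\frac{\mathrm{ch}[M^\epsilon](iy)}{\mathrm{ch}[\mathcal K_{1,1;0}^\epsilon](iy)}.$$ Finally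 let $$B_\epsilon^{p_+p_-}=-\min\Big\{\Big|\tfrac{m}{\sqrt{2p_+p_-}}-\mathrm{Im}\,\epsilon\Big| : m\in\mathbb Z\setminus p_+p_-\mathbb Z\Big\},$$ $$S^\epsilon_{r,s;n}(x)=-e^{-2\pi\epsilon x}e^{-\pi in\sqrt{2p_+p_-}(x+i\epsilon)}\frac{\sin\!\big(2\pi rp_-\frac{x+i\epsilon}{\sqrt{2p_+p_-}}\big)\sin\!\big(2\pi sp_+\frac{x+i\epsilon}{\sqrt{2p_+p_-}}\big)}{\sin\!\big(\pi\sqrt{2p_+p_-}(x+i\epsilon)\big)^2}.$$ **Proposition.** Let $\mathrm{Re}\,\epsilon>B_\epsilon^{p_+p_-}$ and $\mathrm{Re}\,\epsilon\ne0$. Then the following limits exist and have the stated values. (1) For every $\lambda\in\mathbb C$ (in particular whenever $\mathcal F_{\lambda+\alpha_0/2}$ is typical), $$\mathrm{qdim}[\mathcal F_{\lambda+\alpha_0/2}^\epsilon]=\lim_{y\to+\infty}\frac{\mathrm{ch}[\mathcal F^\epsilon_{\lambda+\alpha_0/2}](-1/iy)}{\mathrm{ch}[\mathcal I^\epsilon_{1,1;0}](-1/iy)}=e^{2\pi\lambda\epsilon}\,\frac{\sin(i\pi\sqrt{2p_+p_-}\,\epsilon)^2}{\sin(i\pi\sqrt{2p_+/p_-}\,\epsilon)\,\sin(i\pi\sqrt{2p_-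 /p_+}\,\epsilon)}.$$ (2) For all $1\le r\le p_+$, $1\le s\le p_-$, $n\in\mathbb Z$, $$\mathrm{qdim}[\mathcal I^\epsilon_{r,s;n}]=\lim_{y\to+\infty}\frac{\mathrm{ch}[\mathcal I^\epsilon_{r,s;n}](-1/iy)}{\mathrm{ch}[\mathcal K^\epsilon_{1,1;0}](-1/iy)}=\frac{S^\epsilon_{r,s;n}(0)}{S^\epsilon_{1,1;0}(0)}=e^{\sqrt{2p_+p_-}\,\pi n\epsilon}\,\frac{\sin(ir\pi\sqrt{2p_- /p_+}\,\epsilon)\,\sin(is\pi\sqrt{2p_+/p_-}\,\epsilon)}{\sin(i\pi\sqrt{2p_- /p_+}\,\epsilon)\,\sin(i\pi\sqrt{2p_+/p_-}\,\epsilon)}.$$ (3) As $\epsilon\to0$ within this region, and in particular as $\epsilon\to0^\pm$ along the real axis, $\mathrm{qdim}[\mathcal F_{\lambda+\alpha_0/2}^\epsilon]\to p_+p_-$ and $\mathrm{qdim}[\mathcal I_{r,s;n}^\epsilon]\to rs$. -/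

import Mathlib

open Filter Topology

noncomputable section

namespace Singlet

/-! ### Parameters

Throughout `p` and `q` stand for `p₊` and `p₋`. -/

/-- `α₊ = √(2p₋/p₊)`. -/
def alphaPlus (p q : ℕ) : ℝ := Real.sqrt (2 * q / p)

/-- `α₋ = -√(2p₊/p₋)`. -/
def alphaMinus (p q : ℕ) : ℝ := -Real.sqrt (2 * p / q)

/-- `α₀ = α₊ + α₋`. -/
def alphaZero (p q : ℕ) : ℝ := alphaPlus p q + alphaMinus p q

/-- `α = √(2p₊p₋)`. -/
def alpha (p q : ℕ) : ℝ := Real.sqrt (2 * p * q)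

/-- `α_{r,s;n} = (1-r)/2 α₊ + (1-s)/2 α₋ + n/2 α`. -/
def alphaRS (p q : ℕ) (r s n : ℤ) : ℝ :=
  (1 - (r : ℝ)) / 2 * alphaPlus p q + (1 - (s : ℝ)) / 2 * alphaMinus p q
    + (n : ℝ) / 2 * alpha p q

/-- The central charge `c = 1 - 3α₀²`. -/
def centralCharge (p q : ℕ) : ℝ := 1 - 3 * alphaZero p q ^ 2

/-! ### Heisenberg Fock modules and their characters -/

/-- The space underlying every Fock module: polynomials in the creation operators;
the variable `k` stands for `a_{-(k+1)}`, and `1` is the highest weight vector. -/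
abbrev Fock : Type := MvPolynomial ℕ ℂ

/-- The action of the Heisenberg generator `a_n` on the Fock module `F_λ`. -/
def heis (lam : ℂ) : ℤ → Module.End ℂ Fock
  | Int.ofNat 0 => lam • LinearMap.id
  | Int.ofNat (k + 1) => ((k : ℂ) + 1) • (MvPolynomial.pderiv (R := ℂ) k).toLinearMap
  | Int.negSucc k => LinearMap.mulLeft ℂ (MvPolynomial.X k : Fock)

/-- `[a_m, a_n] = m δ_{m,-n}`. -/
theorem heis_comm (lam : ℂ) (m n : ℤ) (f : Fock) :
    heis lam m (heis lam n f) - heis lam n (heis lam m f)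
      = (if m + n = 0 then (m : ℂ) else 0) • f := by
  rcases m with (_ | j) | j <;> rcases n with (_ | k) | k
  case ofNat.succ.ofNat.succ =>
    have h : ¬ (Int.ofNat (j + 1) + Int.ofNat (k + 1) = 0) := by
      simp only [Int.ofNat_eq_natCast]; omega
    have hc : MvPolynomial.pderiv j (MvPolynomial.pderiv k f)
        = MvPolynomial.pderiv k (MvPolynomial.pderiv j f) := by
      have h0 : ⁅(MvPolynomial.pderiv j : Derivation ℂ Fock Fock),
          (MvPolynomial.pderiv k : Derivation ℂ Fock Fock)⁆ = 0 := by
        refine MvPolynomial.derivation_ext fun i => ?_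
        rw [Derivation.commutator_apply, MvPolynomial.pderiv_X, MvPolynomial.pderiv_X]
        by_cases h1 : k = i <;> by_cases h2 : j = i <;> simp [Pi.single_apply, h1, h2]
      have h1 := congrArg (fun D : Derivation ℂ Fock Fock => D f) h0
      simpa [Derivation.commutator_apply, sub_eq_zero] using h1
    rw [if_neg h]
    simp [heis, hc, smul_smul, mul_comm]
  case ofNat.succ.negSucc =>
    by_cases hjk : j = k
    · subst hjk
      have h : Int.ofNat (j + 1) + Int.negSucc j = 0 := by
        simp only [Int.ofNat_eq_natCast]; omega
      rw [if_pos h]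
      simp [heis, Derivation.leibniz, smul_add]
    · have h : ¬ (Int.ofNat (j + 1) + Int.negSucc k = 0) := by
        simp only [Int.ofNat_eq_natCast]; omega
      rw [if_neg h]
      simp [heis, Derivation.leibniz, MvPolynomial.pderiv_X_of_ne (Ne.symm hjk)]
  case negSucc.ofNat.succ =>
    by_cases hjk : j = k
    · subst hjk
      have h : Int.negSucc j + Int.ofNat (j + 1) = 0 := by
        simp only [Int.ofNat_eq_natCast]; omega
      rw [if_pos h]
      simp [heis, Derivation.leibniz, smul_add, Int.negSucc_eq]
      module
    · have h : ¬ (Int.negSucc j + Int.ofNat (k + 1) = 0) := by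
        simp only [Int.ofNat_eq_natCast]; omega
      rw [if_neg h]
      simp [heis, Derivation.leibniz, MvPolynomial.pderiv_X_of_ne hjk]
  case negSucc.negSucc =>
    have h : ¬ (Int.negSucc j + Int.negSucc k = 0) := by omega
    rw [if_neg h]
    simp [heis, mul_left_comm]
  case ofNat.succ.ofNat.zero =>
    have h : ¬ (Int.ofNat (j + 1) + Int.ofNat 0 = 0) := by
      simp only [Int.ofNat_eq_natCast]; omega
    rw [if_neg h]
    simp [heis, smul_comm lam]
  all_goals simp [heis]
  all_goals module

theorem heis_finite_support (lam : ℂ) (f : Fock) :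
    (Function.support fun k : ℕ =>
      heis lam (Int.negSucc k) (heis lam (Int.ofNat (k + 1)) f)).Finite := by
  refine (f.vars.finite_toSet).subset fun k hk => ?_
  by_contra hkv
  apply hk
  have : MvPolynomial.pderiv k f = 0 :=
    MvPolynomial.pderiv_eq_zero_of_notMem_vars (by simpa using hkv)
  simp [heis, this]

/-- The zero mode of the conformal vector `ω = ½ (a_{-1}² + α₀ a_{-2}) 1` on `F_λ`:
`L(0) = ½ a₀² - ½ α₀ a₀ + ∑_{m ≥ 1} a_{-m} a_m`. -/
def virL0 (p q : ℕ) (lam : ℂ) : Module.End ℂ Fock where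
  toFun f := (1 / 2 : ℂ) • heis lam 0 (heis lam 0 f)
    - ((alphaZero p q : ℂ) / 2) • heis lam 0 f
    + ∑ᶠ k : ℕ, heis lam (Int.negSucc k) (heis lam (Int.ofNat (k + 1)) f)
  map_add' f g := by
    simp only [map_add]
    rw [finsum_add_distrib (heis_finite_support lam f) (heis_finite_support lam g)]
    module
  map_smul' c f := by
    simp only [map_smul, RingHom.id_apply]
    rw [← smul_finsum' c (heis_finite_support lam f)]
    module

/-- The character `ch[F_λ](τ) = tr q^{L(0) - c/24}`, `q = e^{2πiτ}`, i.e. the sum over the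
eigenvalues `h` of `L(0)` of `dim (eigenspace) · q^{h - c/24}`. -/
def chFock (p q : ℕ) (lam : ℂ) (τ : ℂ) : ℂ :=
  ∑' h : ℂ, (Module.finrank ℂ (Module.End.eigenspace (virL0 p q lam) h) : ℂ)
    * Complex.exp (2 * Real.pi * Complex.I * τ * (h - (centralCharge p q : ℂ) / 24))

/-! ### Regularised characters

A regularised character is a function of `ε` and `τ`. -/

/-- `ch[F_λ^ε] = e^{2πε(λ - α₀/2)} ch[F_λ]`. -/
def chF (p q : ℕ) (lam : ℂ) (ε τ : ℂ) : ℂ :=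
  Complex.exp (2 * Real.pi * ε * (lam - (alphaZero p q : ℂ) / 2)) * chFock p q lam τ

/-- `ch[F_{r,s;n}^ε]`, where `F_{r,s;n} = F_{α_{r,s;n}}`. -/
def chFrs (p q : ℕ) (r s n : ℤ) (ε τ : ℂ) : ℂ := chF p q (alphaRS p q r s n : ℂ) ε τ

/-- The (unregularised) character of the irreducible Virasoro minimal model module `L_{r,s}`,
as the Euler-Poincare characteristic of the Felder complex whose cohomology it is:
`∑_{k ∈ ℤ} (ch[F_{r,s;2k}] - ch[F_{p₊-r,s;2k+1}])`. -/
def chVir (p q : ℕ) (r s : ℤ) (τ : ℂ) : ℂ :=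
  ∑' k : ℤ, (chFock p q (alphaRS p q r s (2 * k) : ℂ) τ
    - chFock p q (alphaRS p q (p - r) s (2 * k + 1) : ℂ) τ)

/-- The regularised character of `I⁺_{r,s;n}` (`1 ≤ r < p₊`, `1 ≤ s ≤ p₋`), obtained from its
resolution by Fock modules. -/
def chIplus (p q : ℕ) (r s n : ℤ) (ε τ : ℂ) : ℂ :=
  (if s ≠ q ∧ 1 ≤ n then (if Even n then chVir p q r s τ else -chVir p q r (q - s) τ) else 0)
    + ∑' k : ℕ, (chFrs p q (p - r) s (n - 2 * k - 1) ε τ - chFrs p q r s (n - 2 * k - 2) ε τ)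

/-- The regularised character of `I⁻_{r,s;n}` (`1 ≤ r ≤ p₊`, `1 ≤ s < p₋`), obtained from its
coresolution by Fock modules. -/
def chIminus (p q : ℕ) (r s n : ℤ) (ε τ : ℂ) : ℂ :=
  (if r ≠ p ∧ 0 ≤ n then (if Even n then -chVir p q r s τ else chVir p q r (q - s) τ) else 0)
    + ∑' k : ℕ, (chFrs p q r s (n - 2 * k) ε τ - chFrs p q r (q - s) (n - 2 * k - 1) ε τ)

/-- The regularised character of `I_{r,s;n}` in the interior range `1 ≤ r < p₊`, `1 ≤ s < p₋`. -/
def chIint (p q : ℕ) (r s n : ℤ) (ε τ : ℂ) : ℂ :=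
  (if 0 ≤ n then (n : ℂ) * (if Even n then chVir p q r s τ else -chVir p q r (q - s) τ) else 0)
    + ∑' k : ℕ, ((k : ℂ) + 1) *
      (chFrs p q (p - r) s (n - 2 * k - 1) ε τ + chFrs p q r (q - s) (n - 2 * k - 3) ε τ
        - chFrs p q r s (n - 2 * k - 2) ε τ - chFrs p q (p - r) (q - s) (n - 2 * k - 2) ε τ)

/-- The regularised character of the atypical module `I_{r,s;n}` for `1 ≤ r ≤ p₊`,
`1 ≤ s ≤ p₋`, with the border conventions `I_{p₊,p₋;n} = F_{p₊,p₋;n}`, `I_{p₊,s;n} = I⁻_{p₊,s;n}`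
and `I_{r,p₋;n} = I⁺_{r,p₋;n}`. -/
def chI (p q : ℕ) (r s n : ℤ) (ε τ : ℂ) : ℂ :=
  if r = p then
    if s = q then chFrs p q r s n ε τ else chIminus p q r s n ε τ
  else
    if s = q then chIplus p q r s n ε τ else chIint p q r s n ε τ

/-- The regularised character of the singlet vertex operator algebra itself, `K_{1,1;0}`:
`ch[K_{1,1;0}^ε] = ch[L_{1,1}] + ch[I_{1,1;0}^ε]`. -/
def chVac (p q : ℕ) (ε τ : ℂ) : ℂ := chVir p q 1 1 τ + chI p q 1 1 0 ε τ

/-! ### Regularised quantum dimensions -/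

/-- `qdim[M^ε] = d`: the quotient `ch[M^ε](iy) / ch[V^ε](iy)` converges to `d` as `y → 0⁺`. -/
def HasQdim (p q : ℕ) (ch : ℂ → ℂ → ℂ) (ε d : ℂ) : Prop :=
  Tendsto (fun y : ℝ => ch ε (Complex.I * y) / chVac p q ε (Complex.I * y)) (𝓝[>] 0) (𝓝 d)

/-- The regularised quantum dimension, meaningful where the limit exists. -/
def qdim (p q : ℕ) (ch : ℂ → ℂ → ℂ) (ε : ℂ) : ℂ :=
  limUnder (𝓝[>] (0 : ℝ))
    (fun y : ℝ => ch ε (Complex.I * y) / chVac p q ε (Complex.I * y))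

/-- `B_ε^{p₊p₋} = - min {|m/√(2p₊p₋) - Im ε| : m ∈ ℤ, p₊p₋ ∤ m}`. -/
def wall (p q : ℕ) (ε : ℂ) : ℝ :=
  -sInf {x : ℝ | ∃ m : ℤ, ¬ ((p * q : ℕ) : ℤ) ∣ m ∧ x = |(m : ℝ) / alpha p q - ε.im|}

/-- The region `Re ε > B_ε^{p₊p₋}`, `Re ε ≠ 0`. -/
def region (p q : ℕ) : Set ℂ := {ε : ℂ | wall p q ε < ε.re ∧ ε.re ≠ 0}

/-- The kernel `S^ε_{r,s;n}(x)`. -/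
def sKernel (p q : ℕ) (r s n : ℤ) (ε : ℂ) (x : ℝ) : ℂ :=
  -Complex.exp (-(2 * Real.pi * ε * x))
    * Complex.exp (-(Real.pi * Complex.I * n * (alpha p q : ℂ) * (x + Complex.I * ε)))
    * (Complex.sin (2 * Real.pi * r * q * ((x + Complex.I * ε) / (alpha p q : ℂ)))
        * Complex.sin (2 * Real.pi * s * p * ((x + Complex.I * ε) / (alpha p q : ℂ))))
    / Complex.sin (Real.pi * (alpha p q : ℂ) * (x + Complex.I * ε)) ^ 2

/-- The value claimed for `qdim[F_{λ+α₀/2}^ε]`. -/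
def typicalValue (p q : ℕ) (lam ε : ℂ) : ℂ :=
  Complex.exp (2 * Real.pi * lam * ε)
    * (Complex.sin (Complex.I * Real.pi * (Real.sqrt (2 * p * q) : ℂ) * ε)
        * Complex.sin (Complex.I * Real.pi * (Real.sqrt (2 * p * q) : ℂ) * ε))
    / (Complex.sin (Complex.I * Real.pi * (Real.sqrt (2 * p / q) : ℂ) * ε)
        * Complex.sin (Complex.I * Real.pi * (Real.sqrt (2 * q / p) : ℂ) * ε))

/-- The value claimed for `qdim[I_{r,s;n}^ε]`. -/
def atypicalValue (p q : ℕ) (r s n : ℤ) (ε : ℂ) : ℂ :=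
  Complex.exp ((Real.sqrt (2 * p * q) : ℂ) * Real.pi * n * ε)
    * (Complex.sin (Complex.I * r * Real.pi * (Real.sqrt (2 * q / p) : ℂ) * ε)
        * Complex.sin (Complex.I * s * Real.pi * (Real.sqrt (2 * p / q) : ℂ) * ε))
    / (Complex.sin (Complex.I * Real.pi * (Real.sqrt (2 * q / p) : ℂ) * ε)
        * Complex.sin (Complex.I * Real.pi * (Real.sqrt (2 * p / q) : ℂ) * ε))

end Singlet

end

noncomputable section

namespace Singlet

/-- The energy `∑ (k+1) m_k` of the Fock monomial with exponents `m`. -/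
def energy (m : ℕ →₀ ℕ) : ℕ := m.sum fun k e => (k + 1) * e

/-- The conformal weight of the highest weight vector of `F_λ`. -/
def topWeight (p q : ℕ) (lam : ℂ) : ℂ := 1 / 2 * (lam * lam) - (alphaZero p q : ℂ) / 2 * lam

theorem virL0_monomial (p q : ℕ) (lam : ℂ) (m : ℕ →₀ ℕ) :
    virL0 p q lam (MvPolynomial.monomial m 1)
      = (topWeight p q lam + energy m) • (MvPolynomial.monomial m (1 : ℂ) : Fock) := by
  have h1 : ∀ k : ℕ, heis lam (Int.negSucc k) (heis lam (Int.ofNat (k + 1))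
      (MvPolynomial.monomial m 1)) = (((k + 1) * m k : ℕ) : ℂ) • MvPolynomial.monomial m 1 := by
    intro k
    simp only [heis, LinearMap.smul_apply, LinearMap.mulLeft_apply, mul_smul_comm,
      Derivation.coeFn_coe, MvPolynomial.X_mul_pderiv_monomial]
    rw [← Nat.cast_smul_eq_nsmul ℂ, smul_smul]
    push_cast
    rfl
  have h2 : ∑ᶠ k : ℕ, heis lam (Int.negSucc k) (heis lam (Int.ofNat (k + 1))
      (MvPolynomial.monomial m 1)) = (energy m : ℂ) • MvPolynomial.monomial m 1 := by
    rw [finsum_congr h1, finsum_eq_sum_of_support_subset (s := m.support), ← Finset.sum_smul,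
      energy, Finsupp.sum]
    · push_cast
      rfl
    · intro k hk
      by_contra h
      apply hk
      have : m k = 0 := by simpa using h
      simp [this]
  have h3 : virL0 p q lam (MvPolynomial.monomial m 1) =
      (1 / 2 : ℂ) • heis lam 0 (heis lam 0 (MvPolynomial.monomial m 1))
    - ((alphaZero p q : ℂ) / 2) • heis lam 0 (MvPolynomial.monomial m 1)
    + ∑ᶠ k : ℕ, heis lam (Int.negSucc k) (heis lam (Int.ofNat (k + 1))
      (MvPolynomial.monomial m 1)) := rfl
  have h0 : ∀ f, heis lam 0 f = lam • f := fun f => rfl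
  rw [h3, h2, h0, h0, topWeight]
  module

theorem coeff_virL0 (p q : ℕ) (lam : ℂ) (m : ℕ →₀ ℕ) (f : Fock) :
    MvPolynomial.coeff m (virL0 p q lam f)
      = (topWeight p q lam + energy m) * MvPolynomial.coeff m f := by
  induction f using MvPolynomial.induction_on' with
  | add f g hf hg => rw [map_add, MvPolynomial.coeff_add, MvPolynomial.coeff_add, hf, hg, mul_add]
  | monomial a b =>
    have : (MvPolynomial.monomial a b : Fock) = b • MvPolynomial.monomial a 1 := by
      simp [MvPolynomial.smul_monomial]
    rw [this, map_smul, virL0_monomial]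
    by_cases h : a = m
    · subst h; simp [mul_comm]
    · simp [h]

theorem finrank_eigenspace_virL0 (p q : ℕ) (lam h : ℂ) :
    Module.finrank ℂ (Module.End.eigenspace (virL0 p q lam) h)
      = Nat.card {m : ℕ →₀ ℕ // topWeight p q lam + energy m = h} := by
  have : Module.End.eigenspace (virL0 p q lam) h
      = MvPolynomial.restrictSupport ℂ {m | topWeight p q lam + energy m = h} := by
    ext f
    rw [Module.End.mem_eigenspace_iff, MvPolynomial.mem_restrictSupport_iff, MvPolynomial.ext_iff]
    constructor
    · intro hf m hm
      have h1 := hf m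
      rw [coeff_virL0, MvPolynomial.coeff_smul, smul_eq_mul] at h1
      exact mul_right_cancel₀ (MvPolynomial.mem_support_iff.mp hm) h1
    · intro hf m
      rw [coeff_virL0, MvPolynomial.coeff_smul, smul_eq_mul]
      by_cases hm : m ∈ f.support
      · rw [hf hm]
      · rw [MvPolynomial.notMem_support_iff.mp hm, mul_zero, mul_zero]
  rw [this]
  exact Module.finrank_eq_nat_card_basis (MvPolynomial.basisRestrictSupport ℂ _)

/-- `∏ (1 - x^{k+1})⁻¹` converges: the sum of `x^energy` over all monomials. -/
theorem summable_pow_energy {x : ℝ} (h0 : 0 ≤ x) (h1 : x < 1) :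
    Summable fun m : ℕ →₀ ℕ => x ^ energy m := by
  classical
  refine summable_of_sum_le (c := Real.exp (∑' k : ℕ, x ^ (k + 1) / (1 - x)))
    (fun m => by positivity) fun S => ?_
  obtain ⟨N, hN⟩ : ∃ N, ∀ m ∈ S, m.support ⊆ Finset.range N := by
    obtain ⟨N, hN⟩ := (S.sup fun m => m.support).exists_nat_subset_range
    exact ⟨N, fun m hm => (Finset.le_sup (f := fun m : ℕ →₀ ℕ => m.support) hm).trans hN⟩
  obtain ⟨M, hM⟩ : ∃ M, ∀ m ∈ S, ∀ k, m k < M := by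
    refine ⟨(S.sup fun m => m.sum fun _ e => e) + 1, fun m hm k => Nat.lt_succ_of_le ?_⟩
    refine le_trans ?_ (Finset.le_sup (f := fun m : ℕ →₀ ℕ => m.sum fun _ e => e) hm)
    by_cases hk : k ∈ m.support
    · exact Finset.single_le_sum (f := fun k => m k) (fun _ _ => Nat.zero_le _) hk
    · rw [Finsupp.notMem_support_iff.mp hk]; exact Nat.zero_le _
  have hen : ∀ m ∈ S, x ^ energy m = ∏ k ∈ Finset.range N, x ^ ((k + 1) * m k) := by
    intro m hm
    rw [energy, Finsupp.sum_of_support_subset m (hN m hm) _ (by simp), Finset.prod_pow_eq_pow_sum]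
  calc ∑ m ∈ S, x ^ energy m
      = ∑ m ∈ S, ∏ k : Fin N, x ^ (((k : ℕ) + 1) * m k) := by
        refine Finset.sum_congr rfl fun m hm => ?_
        rw [hen m hm, Finset.prod_range]
    _ = ∑ f ∈ S.image (fun m (k : Fin N) => m k), ∏ k : Fin N, x ^ (((k : ℕ) + 1) * f k) := by
        rw [Finset.sum_image]
        intro a ha b hb hab
        ext k
        by_cases hk : k < N
        · exact congrFun hab ⟨k, hk⟩
        · have hk' : k ∉ Finset.range N := by simpa using hk
          rw [Finsupp.notMem_support_iff.mp fun h => hk' (hN a ha h),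
            Finsupp.notMem_support_iff.mp fun h => hk' (hN b hb h)]
    _ ≤ ∑ f ∈ Fintype.piFinset (fun _ : Fin N => Finset.range M),
          ∏ k : Fin N, x ^ (((k : ℕ) + 1) * f k) := by
        refine Finset.sum_le_sum_of_subset_of_nonneg ?_ fun f _ _ =>
          Finset.prod_nonneg fun _ _ => by positivity
        intro f hf
        obtain ⟨m, hm, rfl⟩ := Finset.mem_image.mp hf
        exact Fintype.mem_piFinset.mpr fun k => Finset.mem_range.mpr (hM m hm k)
    _ = ∏ k : Fin N, ∑ j ∈ Finset.range M, x ^ (((k : ℕ) + 1) * j) :=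
        (Finset.prod_univ_sum (fun _ : Fin N => Finset.range M)
          (fun k j => x ^ (((k : ℕ) + 1) * j))).symm
    _ ≤ ∏ k : Fin N, Real.exp (x ^ ((k : ℕ) + 1) / (1 - x)) := by
        refine Finset.prod_le_prod (fun _ _ => Finset.sum_nonneg fun _ _ => by positivity)
          fun k _ => ?_
        have hx : x ^ ((k : ℕ) + 1) < 1 := pow_lt_one₀ h0 h1 (by omega)
        have hx0 : 0 ≤ x ^ ((k : ℕ) + 1) := by positivity
        have hxx : x ^ ((k : ℕ) + 1) ≤ x := pow_le_of_le_one h0 h1.le (by omega)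
        calc ∑ j ∈ Finset.range M, x ^ (((k : ℕ) + 1) * j)
            = ∑ j ∈ Finset.range M, (x ^ ((k : ℕ) + 1)) ^ j := by simp_rw [pow_mul]
          _ ≤ (1 - x ^ ((k : ℕ) + 1))⁻¹ := by
              rw [← tsum_geometric_of_lt_one hx0 hx]
              exact (summable_geometric_of_lt_one hx0 hx).sum_le_tsum _ fun _ _ => by positivity
          _ = x ^ ((k : ℕ) + 1) / (1 - x ^ ((k : ℕ) + 1)) + 1 := by
              have : 1 - x ^ ((k : ℕ) + 1) ≠ 0 := by linarith
              field_simp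
              ring
          _ ≤ x ^ ((k : ℕ) + 1) / (1 - x) + 1 := by
              gcongr
          _ ≤ _ := Real.add_one_le_exp _
    _ = Real.exp (∑ k ∈ Finset.range N, x ^ (k + 1) / (1 - x)) := by
        rw [← Real.exp_sum, Finset.sum_range]
    _ ≤ _ := by
        refine Real.exp_le_exp.mpr (Summable.sum_le_tsum _ (fun _ _ => ?_) ?_)
        · exact div_nonneg (by positivity) (by linarith)
        · exact ((summable_nat_add_iff 1).mpr (summable_geometric_of_lt_one h0 h1)).div_const _

/-- `q^{-1/24} ∏ (1 - q^n)⁻¹` at `q = e^{-2πy}`. -/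
def fockSum (y : ℝ) : ℝ :=
  Real.exp (2 * Real.pi * y / 24) * ∑' m : ℕ →₀ ℕ, Real.exp (-2 * Real.pi * y) ^ energy m

theorem fockSum_ne_zero {y : ℝ} (hy : 0 < y) : fockSum y ≠ 0 := by
  have hx : Real.exp (-2 * Real.pi * y) < 1 := by
    rw [Real.exp_lt_one_iff]
    have := Real.pi_pos
    nlinarith [mul_pos this hy]
  refine mul_ne_zero (Real.exp_pos _).ne' (ne_of_gt ?_)
  have hpos : ∀ m : ℕ →₀ ℕ, 0 < Real.exp (-2 * Real.pi * y) ^ energy m :=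
    fun m => pow_pos (Real.exp_pos _) _
  exact (summable_pow_energy (Real.exp_pos _).le hx).tsum_pos (fun m => (hpos m).le) 0 (hpos 0)

theorem tsum_card_fiber {x : ℝ} (h0 : 0 ≤ x) (h1 : x < 1) :
    ∑' n : ℕ, (Nat.card {m : ℕ →₀ ℕ // energy m = n} : ℝ) * x ^ n
      = ∑' m : ℕ →₀ ℕ, x ^ energy m := by
  rw [← (summable_pow_energy h0 h1).hasSum.tsum_fiberwise energy |>.tsum_eq]
  refine tsum_congr fun n => ?_
  have : ∀ c : energy ⁻¹' {n}, x ^ energy c.1 = x ^ n := fun c => by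
    rw [show energy c.1 = n from c.2]
  rw [tsum_congr this, tsum_const, nsmul_eq_mul]
  rfl

theorem chFock_eq (p q : ℕ) (lam : ℂ) {y : ℝ} (hy : 0 < y) :
    chFock p q lam (Complex.I * y)
      = Complex.exp (-(Real.pi * y * (lam - (alphaZero p q : ℂ) / 2) ^ 2)) * fockSum y := by
  have hx : Real.exp (-2 * Real.pi * y) < 1 := by
    rw [Real.exp_lt_one_iff]
    have := Real.pi_pos
    nlinarith [mul_pos this hy]
  have hinj : Function.Injective fun n : ℕ => topWeight p q lam + n := fun a b h => by
    simpa using h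
  rw [chFock, ← hinj.tsum_eq (f := fun h : ℂ => (Module.finrank ℂ (Module.End.eigenspace
    (virL0 p q lam) h) : ℂ) * Complex.exp (2 * Real.pi * Complex.I * (Complex.I * y) *
      (h - (centralCharge p q : ℂ) / 24)))]
  · rw [fockSum, ← tsum_card_fiber (Real.exp_pos _).le hx]
    push_cast
    rw [← tsum_mul_left, ← tsum_mul_left]
    refine tsum_congr fun n => ?_
    have hc : Nat.card {m : ℕ →₀ ℕ // topWeight p q lam + energy m = topWeight p q lam + n}
        = Nat.card {m : ℕ →₀ ℕ // energy m = n} :=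
      Nat.card_congr (Equiv.subtypeEquivRight fun m => by simp)
    rw [finrank_eigenspace_virL0, hc, ← Complex.exp_nat_mul, mul_left_comm (Complex.exp _)
      (Nat.card _ : ℂ), mul_left_comm (Complex.exp _) (Nat.card _ : ℂ), ← Complex.exp_add,
      ← Complex.exp_add]
    congr 2
    simp only [topWeight, centralCharge]
    push_cast
    ring_nf
    simp only [Complex.I_sq]
    ring
  · intro h hh
    by_contra hne
    apply hh
    have : IsEmpty {m : ℕ →₀ ℕ // topWeight p q lam + energy m = h} :=
      ⟨fun m => hne ⟨energy m.1, m.2⟩⟩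
    simp only [finrank_eigenspace_virL0, Nat.card_of_isEmpty, Nat.cast_zero, zero_mul]

open Complex in
/-- The Gaussian `e^{2πεu - πyu²}` at `u = m/a`. -/
def gauss (a : ℝ) (ε : ℂ) (y : ℝ) (m : ℤ) : ℂ :=
  cexp (2 * Real.pi * ε * (m / a) - Real.pi * y * (m / a) ^ 2)

open Complex in
/-- The `j`-th term of the Poisson dual of the sum of `gauss` over `c + 2Nℤ`. -/
def dualGauss (a : ℝ) (N : ℕ) (ε : ℂ) (y : ℝ) (c j : ℤ) : ℂ :=
  cexp (Real.pi * I * (j * c / N)) * cexp (Real.pi * (ε - I * (j / a)) ^ 2 / y)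

/-- The prefactor `(2Ny)^{-1/2}` in Poisson summation. -/
def dualFactor (N : ℕ) (y : ℝ) : ℂ := 1 / (2 * N * y : ℂ) ^ (1 / 2 : ℂ)

section Theta

variable {a : ℝ} {N : ℕ}

open Complex

theorem gauss_add_eq (ha : 0 < a) (hN : a ^ 2 = 2 * N) (ε : ℂ) (y : ℝ) (c k : ℤ) :
    gauss a ε y (c + 2 * N * k)
      = gauss a ε y c * jacobiTheta₂_term k (-I * (ε * a - y * c)) (2 * I * N * y) := by
  have hN' : (N : ℂ) = a ^ 2 / 2 := by
    have : (a : ℂ) ^ 2 = 2 * N := by exact_mod_cast hN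
    rw [this]; ring
  have ha' : (a : ℂ) ≠ 0 := by exact_mod_cast ha.ne'
  rw [gauss, gauss, jacobiTheta₂_term, ← Complex.exp_add]
  congr 1
  push_cast
  rw [hN']
  field_simp
  ring_nf
  simp only [I_sq]
  ring

theorem dualGauss_eq (ha : 0 < a) (hN : a ^ 2 = 2 * N) (ε : ℂ) {y : ℝ} (hy : 0 < y) (c j : ℤ) :
    dualGauss a N ε y c j = gauss a ε y c *
      cexp (-Real.pi * I * (-I * (ε * a - y * c)) ^ 2 / (2 * I * N * y)) *
      jacobiTheta₂_term j ((-I * (ε * a - y * c)) / (2 * I * N * y)) (-1 / (2 * I * N * y)) := by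
  have hN' : (N : ℂ) = a ^ 2 / 2 := by
    have : (a : ℂ) ^ 2 = 2 * N := by exact_mod_cast hN
    rw [this]; ring
  have ha' : (a : ℂ) ≠ 0 := by exact_mod_cast ha.ne'
  have hy' : (y : ℂ) ≠ 0 := by exact_mod_cast hy.ne'
  rw [dualGauss, gauss, jacobiTheta₂_term, ← Complex.exp_add, ← Complex.exp_add, ← Complex.exp_add]
  congr 1
  rw [hN']
  field_simp
  ring_nf
  simp only [I_sq]
  ring

theorem tau_im_pos (ha : 0 < a) (hN : a ^ 2 = 2 * N) {y : ℝ} (hy : 0 < y) :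
    0 < (2 * I * N * y : ℂ).im := by
  have : (2 * I * N * y : ℂ) = ((2 * N * y : ℝ) : ℂ) * I := by push_cast; ring
  rw [this, Complex.im_ofReal_mul, I_im, mul_one, ← hN]
  positivity

theorem neg_inv_tau_im_pos (ha : 0 < a) (hN : a ^ 2 = 2 * N) {y : ℝ} (hy : 0 < y) :
    0 < (-1 / (2 * I * N * y) : ℂ).im := by
  have h0 : (0 : ℝ) < 2 * N := by rw [← hN]; positivity
  have : (-1 / (2 * I * N * y) : ℂ) = ((1 / (2 * N * y) : ℝ) : ℂ) * I := by
    have h1 : (N : ℂ) ≠ 0 := by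
      intro h
      rw [Nat.cast_eq_zero.mp h] at h0
      simp at h0
    have hy' : (y : ℂ) ≠ 0 := by exact_mod_cast hy.ne'
    push_cast
    field_simp
    rw [I_sq]
  rw [this, Complex.im_ofReal_mul, I_im, mul_one]
  positivity

theorem summable_gauss (ha : 0 < a) (hN : a ^ 2 = 2 * N) (ε : ℂ) {y : ℝ} (hy : 0 < y) (c : ℤ) :
    Summable fun k : ℤ => gauss a ε y (c + 2 * N * k) := by
  simp_rw [gauss_add_eq ha hN]
  exact ((summable_jacobiTheta₂_term_iff _ _).mpr (tau_im_pos ha hN hy)).mul_left _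

theorem summable_mul_gauss (ha : 0 < a) (hN : a ^ 2 = 2 * N) (ε : ℂ) {y : ℝ} (hy : 0 < y)
    (c : ℤ) : Summable fun k : ℤ => (k : ℂ) * gauss a ε y (c + 2 * N * k) := by
  have h := ((summable_jacobiTheta₂'_term_iff (-I * (ε * a - y * c)) (2 * I * N * y)).mpr
    (tau_im_pos ha hN hy)).mul_left (gauss a ε y c / (2 * Real.pi * I))
  refine h.congr fun k => ?_
  have : (Real.pi : ℂ) ≠ 0 := by exact_mod_cast Real.pi_ne_zero
  rw [jacobiTheta₂'_term, gauss_add_eq ha hN]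
  have := I_ne_zero
  field_simp

theorem summable_dualGauss (ha : 0 < a) (hN : a ^ 2 = 2 * N) (ε : ℂ) {y : ℝ} (hy : 0 < y)
    (c : ℤ) : Summable fun j : ℤ => dualGauss a N ε y c j := by
  simp_rw [dualGauss_eq ha hN ε hy]
  exact ((summable_jacobiTheta₂_term_iff _ _).mpr (neg_inv_tau_im_pos ha hN hy)).mul_left _

theorem summable_mul_dualGauss (ha : 0 < a) (hN : a ^ 2 = 2 * N) (ε : ℂ) {y : ℝ} (hy : 0 < y)
    (c : ℤ) : Summable fun j : ℤ => (ε * a - I * j) * dualGauss a N ε y c j := by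
  have h := ((summable_jacobiTheta₂'_term_iff ((-I * (ε * a - y * c)) / (2 * I * N * y))
    (-1 / (2 * I * N * y))).mpr (neg_inv_tau_im_pos ha hN hy)).mul_left
    (gauss a ε y c * cexp (-Real.pi * I * (-I * (ε * a - y * c)) ^ 2 / (2 * I * N * y))
      * (-1 / (2 * Real.pi)))
  refine (((summable_dualGauss ha hN ε hy c).mul_left (ε * a)).add h).congr fun k => ?_
  have : (Real.pi : ℂ) ≠ 0 := by exact_mod_cast Real.pi_ne_zero
  rw [jacobiTheta₂'_term, dualGauss_eq ha hN ε hy]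
  field_simp
  ring

theorem dualFactor_eq (N : ℕ) (y : ℝ) :
    1 / (-I * (2 * I * N * y)) ^ (1 / 2 : ℂ) = dualFactor N y := by
  rw [dualFactor]
  congr 2
  ring_nf
  simp only [I_sq]
  ring

/-- Poisson summation for the Gaussian over `c + 2Nℤ`. -/
theorem tsum_gauss (ha : 0 < a) (hN : a ^ 2 = 2 * N) (ε : ℂ) {y : ℝ} (hy : 0 < y) (c : ℤ) :
    ∑' k : ℤ, gauss a ε y (c + 2 * N * k)
      = dualFactor N y * ∑' j : ℤ, dualGauss a N ε y c j := by
  simp_rw [gauss_add_eq ha hN, dualGauss_eq ha hN ε hy]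
  rw [tsum_mul_left, tsum_mul_left, ← jacobiTheta₂, jacobiTheta₂_functional_equation, dualFactor_eq,
    ← jacobiTheta₂]
  ring

/-- Poisson summation for `m ↦ m · gauss m` over `c + 2Nℤ`. -/
theorem tsum_mul_gauss (ha : 0 < a) (hN : a ^ 2 = 2 * N) (ε : ℂ) {y : ℝ} (hy : 0 < y) (c : ℤ) :
    ∑' k : ℤ, ((c + 2 * N * k : ℤ) : ℂ) * gauss a ε y (c + 2 * N * k)
      = dualFactor N y / y * ∑' j : ℤ, (ε * a - I * j) * dualGauss a N ε y c j := by
  have hpi : (Real.pi : ℂ) ≠ 0 := by exact_mod_cast Real.pi_ne_zero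
  have hy' : (y : ℂ) ≠ 0 := by exact_mod_cast hy.ne'
  have hI := I_ne_zero
  have hN0 : (N : ℂ) ≠ 0 := by
    intro h
    rw [Nat.cast_eq_zero.mp h] at hN
    simp at hN
    exact ha.ne' hN
  set z : ℂ := -I * (ε * a - y * c) with hz
  set τ : ℂ := 2 * I * N * y with hτ
  have h1 : ∑' k : ℤ, ((c + 2 * N * k : ℤ) : ℂ) * gauss a ε y (c + 2 * N * k)
      = c * (gauss a ε y c * jacobiTheta₂ z τ)
        + 2 * N / (2 * Real.pi * I) * (gauss a ε y c * jacobiTheta₂' z τ) := by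
    rw [jacobiTheta₂, jacobiTheta₂', ← tsum_mul_left, ← tsum_mul_left, ← tsum_mul_left,
      ← tsum_mul_left, ← Summable.tsum_add]
    · refine tsum_congr fun k => ?_
      rw [gauss_add_eq ha hN, jacobiTheta₂'_term, ← hz, ← hτ]
      push_cast
      field_simp
    · exact (((summable_jacobiTheta₂_term_iff z τ).mpr (tau_im_pos ha hN hy)).mul_left _).mul_left _
    · exact (((summable_jacobiTheta₂'_term_iff z τ).mpr
        (tau_im_pos ha hN hy)).mul_left _).mul_left _
  have h2 : ∑' j : ℤ, (ε * a - I * j) * dualGauss a N ε y c j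
      = gauss a ε y c * cexp (-Real.pi * I * z ^ 2 / τ) *
        (ε * a * jacobiTheta₂ (z / τ) (-1 / τ)
          - 1 / (2 * Real.pi) * jacobiTheta₂' (z / τ) (-1 / τ)) := by
    rw [jacobiTheta₂, jacobiTheta₂', ← tsum_mul_left, ← tsum_mul_left, ← Summable.tsum_sub,
      ← tsum_mul_left]
    · refine tsum_congr fun j => ?_
      rw [dualGauss_eq ha hN ε hy, jacobiTheta₂'_term, ← hz, ← hτ]
      field_simp
    · exact ((summable_jacobiTheta₂_term_iff _ _).mpr (neg_inv_tau_im_pos ha hN hy)).mul_left _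
    · exact ((summable_jacobiTheta₂'_term_iff _ _).mpr (neg_inv_tau_im_pos ha hN hy)).mul_left _
  rw [h1, h2, jacobiTheta₂_functional_equation z τ, jacobiTheta₂'_functional_equation z τ, hτ,
    dualFactor_eq, ← hτ]
  generalize jacobiTheta₂ (z / τ) (-1 / τ) = T
  generalize jacobiTheta₂' (z / τ) (-1 / τ) = T'
  generalize cexp (-Real.pi * I * z ^ 2 / τ) = e
  generalize gauss a ε y c = g
  rw [hz, hτ]
  field_simp
  ring_nf
  simp only [I_sq]
  ring

end Theta

section Theta

variable {a : ℝ} {N : ℕ}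

open Complex

theorem norm_dualGauss (ε : ℂ) (y : ℝ) (c j : ℤ) :
    ‖dualGauss a N ε y c j‖ = Real.exp (-(Real.pi * ((ε.im - j / a) ^ 2 - ε.re ^ 2) / y)) := by
  have h1 : (Real.pi * I * (j * c / N) : ℂ) = ((Real.pi * (j * c / N) : ℝ) : ℂ) * I := by
    push_cast; ring
  have h2 : ε - I * (j / a) = (ε.re : ℂ) + ((ε.im - j / a : ℝ) : ℂ) * I := by
    conv_lhs => rw [← re_add_im ε]
    push_cast; ring
  have h3 : (Real.pi * (ε - I * (j / a)) ^ 2 / y : ℂ)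
      = ((-(Real.pi * ((ε.im - j / a) ^ 2 - ε.re ^ 2) / y) : ℝ) : ℂ)
        + ((Real.pi * (2 * ε.re * (ε.im - j / a)) / y : ℝ) : ℂ) * I := by
    rw [h2]
    push_cast
    ring_nf
    simp only [I_sq]
    ring
  rw [dualGauss, norm_mul, h1, norm_exp_ofReal_mul_I, one_mul, norm_exp, h3]
  congr 1
  rw [add_re, ofReal_re, re_ofReal_mul, I_re, mul_zero, add_zero]

theorem dualGauss_congr (hN : N ≠ 0) (ε : ℂ) (y : ℝ) {c c' j : ℤ} (hc : c ≡ c' [ZMOD 2])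
    (hj : (N : ℤ) ∣ j) : dualGauss a N ε y c j = dualGauss a N ε y c' j := by
  obtain ⟨l, rfl⟩ := hj
  obtain ⟨t, ht⟩ := hc.symm.dvd
  have hN' : (N : ℂ) ≠ 0 := by exact_mod_cast hN
  have : (Real.pi * I * (((N * l : ℤ) : ℂ) * c / N) : ℂ)
      = Real.pi * I * (((N * l : ℤ) : ℂ) * c' / N) + ((l * t : ℤ) : ℂ) * (2 * Real.pi * I) := by
    have hc : (c : ℂ) = c' + 2 * t := by exact_mod_cast (by linarith : c = c' + 2 * t)
    rw [hc]
    push_cast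
    field_simp
  rw [dualGauss, dualGauss, this, exp_periodic.int_mul]

/-- The distance condition: `Re ε` is separated from all the walls `j/a`, `N ∤ j`. -/
def WallGap (a : ℝ) (N : ℕ) (ε : ℂ) (δ : ℝ) : Prop :=
  ∀ j : ℤ, ¬ (N : ℤ) ∣ j → δ ≤ (ε.im - j / a) ^ 2 - ε.re ^ 2

theorem norm_dualGauss_le {ε : ℂ} {δ : ℝ} (hg : WallGap a N ε δ) {y : ℝ} (hy : 0 < y)
    (hy1 : y ≤ 1) (c c' : ℤ) {j : ℤ} (hj : ¬ (N : ℤ) ∣ j) :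
    ‖dualGauss a N ε y c j‖
      ≤ Real.exp (-(Real.pi * δ * (1 / y - 1))) * ‖dualGauss a N ε 1 c' j‖ := by
  rw [norm_dualGauss, norm_dualGauss, ← Real.exp_add, Real.exp_le_exp]
  have h1 := hg j hj
  have h2 : 0 ≤ 1 / y - 1 := by
    rw [sub_nonneg, le_div_iff₀ hy]; linarith
  have h3 := mul_le_mul_of_nonneg_left h1 (mul_nonneg Real.pi_pos.le h2)
  have h4 : Real.pi * ((ε.im - j / a) ^ 2 - ε.re ^ 2) / y
      = Real.pi * (1 / y - 1) * ((ε.im - j / a) ^ 2 - ε.re ^ 2)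
        + Real.pi * ((ε.im - j / a) ^ 2 - ε.re ^ 2) := by ring
  rw [h4]
  linarith

theorem norm_dualFactor_div_le (hN : N ≠ 0) {y : ℝ} (hy : 0 < y) (hy1 : y ≤ 1) :
    ‖dualFactor N y / y‖ ≤ (1 / y) ^ 2 := by
  have hN1 : (1 : ℝ) ≤ N := by exact_mod_cast Nat.one_le_iff_ne_zero.mpr hN
  have h0 : (2 * N * y : ℂ) = ((2 * N * y : ℝ) : ℂ) := by push_cast; rfl
  have h1 : 0 < 2 * N * y := by positivity
  have h2 : y ≤ (2 * N * y) ^ (1 / 2 : ℝ) := by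
    rw [← Real.sqrt_eq_rpow]
    apply Real.le_sqrt_of_sq_le
    nlinarith
  rw [norm_div, dualFactor, h0, norm_div, norm_cpow_eq_rpow_re_of_pos h1, norm_one, norm_real,
    Real.norm_of_nonneg hy.le, one_div_pow, div_div]
  have h3 : ((1 / 2 : ℂ)).re = 1 / 2 := by norm_num
  rw [h3]
  gcongr
  nlinarith

theorem norm_tsum_dualGauss_sub_le (hN : N ≠ 0) {ε : ℂ} {δ : ℝ} (hg : WallGap a N ε δ)
    {w : ℤ → ℂ} (hw : ∀ y : ℝ, 0 < y → ∀ c : ℤ, Summable fun j => w j * dualGauss a N ε y c j)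
    {c c' : ℤ} (hc : c ≡ c' [ZMOD 2]) {y : ℝ} (hy : 0 < y) (hy1 : y ≤ 1) :
    ‖∑' j, w j * dualGauss a N ε y c j - ∑' j, w j * dualGauss a N ε y c' j‖
      ≤ Real.exp (-(Real.pi * δ * (1 / y - 1))) * (2 * ∑' j, ‖w j * dualGauss a N ε 1 0 j‖) := by
  rw [← (hw y hy c).tsum_sub (hw y hy c'), ← tsum_mul_left, ← tsum_mul_left]
  refine tsum_of_norm_bounded (((hw 1 one_pos 0).norm.mul_left _).mul_left _).hasSum fun j => ?_
  by_cases hj : (N : ℤ) ∣ j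
  · rw [dualGauss_congr hN ε y hc hj, sub_self, norm_zero]
    positivity
  · rw [← mul_sub, norm_mul, norm_mul]
    have h1 := norm_dualGauss_le hg hy hy1 c 0 hj
    have h2 := norm_dualGauss_le hg hy hy1 c' 0 hj
    have h3 := norm_sub_le (dualGauss a N ε y c j) (dualGauss a N ε y c' j)
    calc _ ≤ ‖w j‖ * (2 * (Real.exp (-(Real.pi * δ * (1 / y - 1)))
            * ‖dualGauss a N ε 1 0 j‖)) := by
          gcongr
          linarith
      _ = _ := by ring

theorem tendsto_dualGauss_sub (hN : N ≠ 0) {ε : ℂ} {δ : ℝ} (hδ : 0 < δ) (hg : WallGap a N ε δ)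
    {w : ℤ → ℂ} (hw : ∀ y : ℝ, 0 < y → ∀ c : ℤ, Summable fun j => w j * dualGauss a N ε y c j)
    {c c' : ℤ} (hc : c ≡ c' [ZMOD 2]) :
    Tendsto (fun y : ℝ => dualFactor N y / y * (∑' j, w j * dualGauss a N ε y c j
      - ∑' j, w j * dualGauss a N ε y c' j)) (𝓝[>] 0) (𝓝 0) := by
  have h1 : Tendsto (fun y : ℝ => (1 / y) ^ 2 * (Real.exp (-(Real.pi * δ * (1 / y - 1)))
      * (2 * ∑' j, ‖w j * dualGauss a N ε 1 0 j‖))) (𝓝[>] 0) (𝓝 0) := by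
    have hb : 0 < Real.pi * δ := by positivity
    have h2 : Tendsto (fun x : ℝ => x ^ 2 * Real.exp (-(Real.pi * δ) * x)) atTop (𝓝 0) := by
      simpa using tendsto_rpow_mul_exp_neg_mul_atTop_nhds_zero 2 _ hb
    have h3 := (h2.comp tendsto_inv_nhdsGT_zero).mul_const
      (Real.exp (Real.pi * δ) * (2 * ∑' j, ‖w j * dualGauss a N ε 1 0 j‖))
    rw [zero_mul] at h3
    refine h3.congr fun y => ?_
    have : -(Real.pi * δ * (1 / y - 1)) = -(Real.pi * δ) * y⁻¹ + Real.pi * δ := by ring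
    rw [this, Real.exp_add]
    simp only [Function.comp, one_div]
    ring
  refine squeeze_zero_norm' ?_ h1
  filter_upwards [Ioc_mem_nhdsGT (zero_lt_one (α := ℝ))] with y hy
  rw [norm_mul]
  exact mul_le_mul (norm_dualFactor_div_le hN hy.1 hy.2)
    (norm_tsum_dualGauss_sub_le hN hg hw hc hy.1 hy.2) (norm_nonneg _) (by positivity)

theorem ne_zero_of_sq_eq (ha : 0 < a) (hN : a ^ 2 = 2 * N) : N ≠ 0 := by
  rintro rfl
  simp at hN
  exact ha.ne' hN

/-- Away from the walls, Gaussian sums over two classes of the same parity agree as `y → 0`. -/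
theorem tendsto_tsum_gauss_sub (ha : 0 < a) (hN : a ^ 2 = 2 * N) {ε : ℂ} {δ : ℝ} (hδ : 0 < δ)
    (hg : WallGap a N ε δ) {c c' : ℤ} (hc : c ≡ c' [ZMOD 2]) :
    Tendsto (fun y : ℝ => ∑' k : ℤ, gauss a ε y (c + 2 * N * k)
      - ∑' k : ℤ, gauss a ε y (c' + 2 * N * k)) (𝓝[>] 0) (𝓝 0) := by
  have h1 := tendsto_dualGauss_sub (w := fun _ => 1) (ne_zero_of_sq_eq ha hN) hδ hg
    (fun y hy c => by simpa using summable_dualGauss ha hN ε hy c) hc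
  have h2 : Tendsto (fun y : ℝ => (y : ℂ)) (𝓝[>] 0) (𝓝 0) := by
    have : Tendsto (fun y : ℝ => (y : ℂ)) (𝓝 0) (𝓝 ((0 : ℝ) : ℂ)) :=
      Complex.continuous_ofReal.tendsto 0
    exact (by simpa using this : Tendsto (fun y : ℝ => (y : ℂ)) (𝓝 0) (𝓝 0)).mono_left
      nhdsWithin_le_nhds
  have h3 := h2.mul h1
  rw [zero_mul] at h3
  refine h3.congr' ?_
  filter_upwards [self_mem_nhdsWithin] with y hy
  have hy' : (y : ℂ) ≠ 0 := by exact_mod_cast (ne_of_gt hy)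
  rw [tsum_gauss ha hN ε hy, tsum_gauss ha hN ε hy]
  simp only [one_mul]
  field_simp

theorem tendsto_tsum_mul_gauss_sub (ha : 0 < a) (hN : a ^ 2 = 2 * N) {ε : ℂ} {δ : ℝ} (hδ : 0 < δ)
    (hg : WallGap a N ε δ) {c c' : ℤ} (hc : c ≡ c' [ZMOD 2]) :
    Tendsto (fun y : ℝ => ∑' k : ℤ, ((c + 2 * N * k : ℤ) : ℂ) * gauss a ε y (c + 2 * N * k)
      - ∑' k : ℤ, ((c' + 2 * N * k : ℤ) : ℂ) * gauss a ε y (c' + 2 * N * k)) (𝓝[>] 0) (𝓝 0) := by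
  refine (tendsto_dualGauss_sub (w := fun j => ε * a - I * j) (ne_zero_of_sq_eq ha hN) hδ hg
    (fun y hy c => summable_mul_dualGauss ha hN ε hy c) hc).congr' ?_
  filter_upwards [self_mem_nhdsWithin] with y hy
  rw [tsum_mul_gauss ha hN ε hy, tsum_mul_gauss ha hN ε hy]
  ring

end Theta

section HalfSums

variable {a : ℝ} {N : ℕ}

open Complex

/-- `∑_{k ≥ 0} gauss ((n-1-2k)N + d)`. -/
def halfSum (a : ℝ) (N : ℕ) (ε : ℂ) (n d : ℤ) (y : ℝ) : ℂ :=
  ∑' k : ℕ, gauss a ε y ((n - 1 - 2 * k) * N + d)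

/-- `∑_{k ≥ 0} (k+1) gauss ((n-2-2k)N + d)`. -/
def weightedHalfSum (a : ℝ) (N : ℕ) (ε : ℂ) (n d : ℤ) (y : ℝ) : ℂ :=
  ∑' k : ℕ, ((k : ℂ) + 1) * gauss a ε y ((n - 2 - 2 * k) * N + d)

theorem gauss_neg (ε : ℂ) (y : ℝ) (m : ℤ) : gauss a (-ε) y (-m) = gauss a ε y m := by
  simp only [gauss]
  congr 1
  push_cast
  ring

theorem gauss_zero_add (ε : ℂ) (m l : ℤ) :
    gauss a ε 0 (m + l) = gauss a ε 0 m * gauss a ε 0 l := by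
  simp only [gauss]
  rw [← Complex.exp_add]
  congr 1
  push_cast
  ring

theorem gauss_zero_pow (ε : ℂ) (m : ℤ) (k : ℕ) :
    gauss a ε 0 (m * k) = gauss a ε 0 m ^ k := by
  simp only [gauss]
  rw [← Complex.exp_nat_mul]
  congr 1
  push_cast
  ring

theorem norm_gauss_zero (ε : ℂ) (m : ℤ) :
    ‖gauss a ε 0 m‖ = Real.exp (2 * Real.pi * ε.re * (m / a)) := by
  have : (2 * Real.pi * ε * (m / a) - Real.pi * ((0 : ℝ) : ℂ) * (m / a) ^ 2 : ℂ)
      = ((2 * Real.pi * (m / a) : ℝ) : ℂ) * ε := by push_cast; ring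
  rw [gauss, norm_exp, this, re_ofReal_mul]
  ring_nf

theorem norm_gauss_le (ε : ℂ) {y : ℝ} (hy : 0 ≤ y) (m : ℤ) :
    ‖gauss a ε y m‖ ≤ ‖gauss a ε 0 m‖ := by
  have : gauss a ε y m = gauss a ε 0 m * cexp ((-(Real.pi * y * (m / a) ^ 2) : ℝ) : ℂ) := by
    simp only [gauss]
    rw [← Complex.exp_add]
    congr 1
    push_cast
    ring
  rw [this, norm_mul, norm_exp, ofReal_re]
  refine mul_le_of_le_one_right (norm_nonneg _) (Real.exp_le_one_iff.mpr ?_)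
  have := Real.pi_pos
  exact neg_nonpos.mpr (by positivity)

theorem tendsto_gauss (ε : ℂ) (m : ℤ) :
    Tendsto (fun y : ℝ => gauss a ε y m) (𝓝[>] 0) (𝓝 (gauss a ε 0 m)) := by
  have : Continuous fun y : ℝ => gauss a ε y m := by
    unfold gauss
    fun_prop
  exact (this.tendsto 0).mono_left nhdsWithin_le_nhds

theorem norm_gauss_neg_lt_one (ha : 0 < a) (hN : N ≠ 0) {ε : ℂ} (hε : 0 < ε.re) :
    ‖gauss a ε 0 (-2 * N)‖ < 1 := by
  rw [norm_gauss_zero, Real.exp_lt_one_iff]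
  have hN' : (0 : ℝ) < N := by positivity
  have := Real.pi_pos
  have h : 2 * Real.pi * ε.re * (((-2 * N : ℤ) : ℝ) / a) = -(4 * Real.pi * ε.re * (N / a)) := by
    push_cast; ring
  rw [h]
  exact neg_neg_of_pos (by positivity)

theorem gauss_zero_sub_ne_zero (ha : 0 < a) {m : ℤ} (hm : m ≠ 0) {ε : ℂ} (hε : ε.re ≠ 0) :
    gauss a ε 0 m - gauss a ε 0 (-m) ≠ 0 := by
  intro h
  have h1 := congrArg norm (sub_eq_zero.mp h)
  rw [norm_gauss_zero, norm_gauss_zero, Real.exp_eq_exp] at h1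
  have h2 : Real.pi * ε.re * (m / a) = 0 := by
    push_cast at h1
    rw [neg_div] at h1
    linarith
  have hm' : (m : ℝ) ≠ 0 := by exact_mod_cast hm
  exact mul_ne_zero (mul_ne_zero Real.pi_ne_zero hε) (div_ne_zero hm' ha.ne') h2

theorem gauss_zero_mul_neg (ε : ℂ) (m : ℤ) : gauss a ε 0 m * gauss a ε 0 (-m) = 1 := by
  rw [← gauss_zero_add, add_neg_cancel, gauss]
  simp

theorem tendsto_halfSum_of_pos (ha : 0 < a) (hN : N ≠ 0) {ε : ℂ} (hε : 0 < ε.re) (n d : ℤ) :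
    Tendsto (halfSum a N ε n d) (𝓝[>] 0)
      (𝓝 (gauss a ε 0 (n * N + d) / (gauss a ε 0 N - gauss a ε 0 (-N)))) := by
  have hr := norm_gauss_neg_lt_one ha hN hε
  have hN' : (N : ℤ) ≠ 0 := by exact_mod_cast hN
  have hne := gauss_zero_sub_ne_zero ha hN' hε.ne'
  have hZ : ∀ k : ℕ, gauss a ε 0 ((n - 1 - 2 * k) * N + d)
      = gauss a ε 0 (n * N + d) * gauss a ε 0 (-N) * gauss a ε 0 (-2 * N) ^ k := by
    intro k
    rw [← gauss_zero_pow, ← gauss_zero_add, ← gauss_zero_add]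
    congr 1
    ring
  have h2 : gauss a ε 0 (-2 * N) = gauss a ε 0 (-N) * gauss a ε 0 (-N) := by
    rw [← gauss_zero_add]; congr 1; ring
  have hval : ∑' k : ℕ, gauss a ε 0 ((n - 1 - 2 * k) * N + d)
      = gauss a ε 0 (n * N + d) / (gauss a ε 0 N - gauss a ε 0 (-N)) := by
    simp_rw [hZ]
    rw [tsum_mul_left, tsum_geometric_of_norm_lt_one hr]
    have h1 := gauss_zero_mul_neg (a := a) ε N
    have h3 : 1 - gauss a ε 0 (-2 * N)
        = gauss a ε 0 (-N) * (gauss a ε 0 N - gauss a ε 0 (-N)) := by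
      rw [h2, mul_sub, mul_comm _ (gauss a ε 0 N), h1]
    have h4 : gauss a ε 0 (-N) ≠ 0 := Complex.exp_ne_zero _
    rw [h3]
    field_simp
  rw [← hval]
  refine tendsto_tsum_of_dominated_convergence
    (bound := fun k => ‖gauss a ε 0 ((n - 1 - 2 * k) * N + d)‖) ?_ (fun k => tendsto_gauss ε _) ?_
  · simp_rw [hZ, norm_mul, norm_pow]
    exact (summable_geometric_of_lt_one (norm_nonneg _) hr).mul_left _
  · filter_upwards [self_mem_nhdsWithin] with y hy k
    exact norm_gauss_le ε (le_of_lt hy) _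

theorem tendsto_weightedHalfSum_of_pos (ha : 0 < a) (hN : N ≠ 0) {ε : ℂ} (hε : 0 < ε.re)
    (n d : ℤ) :
    Tendsto (weightedHalfSum a N ε n d) (𝓝[>] 0)
      (𝓝 (gauss a ε 0 (n * N + d) / (gauss a ε 0 N - gauss a ε 0 (-N)) ^ 2)) := by
  have hr := norm_gauss_neg_lt_one ha hN hε
  have hN' : (N : ℤ) ≠ 0 := by exact_mod_cast hN
  have hne := gauss_zero_sub_ne_zero ha hN' hε.ne'
  have hZ : ∀ k : ℕ, gauss a ε 0 ((n - 2 - 2 * k) * N + d)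
      = gauss a ε 0 (n * N + d) * gauss a ε 0 (-2 * N) * gauss a ε 0 (-2 * N) ^ k := by
    intro k
    rw [← gauss_zero_pow, ← gauss_zero_add, ← gauss_zero_add]
    congr 1
    ring
  have h2 : gauss a ε 0 (-2 * N) = gauss a ε 0 (-N) * gauss a ε 0 (-N) := by
    rw [← gauss_zero_add]; congr 1; ring
  have hgeo : ∀ {r : ℂ}, ‖r‖ < 1 → HasSum (fun k : ℕ => ((k : ℂ) + 1) * r ^ k) (1 / (1 - r) ^ 2) :=
    fun {r} hr => by
      simpa [Nat.choose_one_right] using hasSum_choose_mul_geometric_of_norm_lt_one 1 hr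
  have hval : ∑' k : ℕ, ((k : ℂ) + 1) * gauss a ε 0 ((n - 2 - 2 * k) * N + d)
      = gauss a ε 0 (n * N + d) / (gauss a ε 0 N - gauss a ε 0 (-N)) ^ 2 := by
    simp_rw [hZ, mul_left_comm ((_ : ℂ) + 1)]
    rw [tsum_mul_left, (hgeo hr).tsum_eq]
    have h1 := gauss_zero_mul_neg (a := a) ε N
    have h3 : 1 - gauss a ε 0 (-2 * N)
        = gauss a ε 0 (-N) * (gauss a ε 0 N - gauss a ε 0 (-N)) := by
      rw [h2, mul_sub, mul_comm _ (gauss a ε 0 N), h1]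
    have h4 : gauss a ε 0 (-N) ≠ 0 := Complex.exp_ne_zero _
    rw [h3, h2]
    field_simp
  rw [← hval]
  refine tendsto_tsum_of_dominated_convergence
    (bound := fun k => ‖((k : ℂ) + 1) * gauss a ε 0 ((n - 2 - 2 * k) * N + d)‖) ?_
    (fun k => (tendsto_gauss ε _).const_mul _) ?_
  · simp_rw [hZ, mul_left_comm ((_ : ℂ) + 1)]
    exact ((hgeo hr).summable.mul_left _).norm
  · filter_upwards [self_mem_nhdsWithin] with y hy k
    rw [norm_mul, norm_mul]
    exact mul_le_mul_of_nonneg_left (norm_gauss_le ε (le_of_lt hy) _) (norm_nonneg _)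

theorem summable_gauss_desc (ha : 0 < a) (hN : a ^ 2 = 2 * N) (ε : ℂ) {y : ℝ} (hy : 0 < y)
    (n d : ℤ) : Summable fun k : ℤ => gauss a ε y ((n - 2 * k) * N + d) := by
  refine ((Equiv.neg ℤ).summable_iff.mpr (summable_gauss ha hN ε hy (n * N + d))).congr fun k => ?_
  simp only [Function.comp, Equiv.neg_apply]
  congr 1
  ring

theorem summable_mul_gauss_desc (ha : 0 < a) (hN : a ^ 2 = 2 * N) (ε : ℂ) {y : ℝ} (hy : 0 < y)
    (n d : ℤ) : Summable fun k : ℤ => ((k : ℂ) + 1) * gauss a ε y ((n - 2 * k) * N + d) := by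
  have h := ((Equiv.neg ℤ).summable_iff.mpr (summable_mul_gauss ha hN ε hy (n * N + d))).neg
  refine (h.add (summable_gauss_desc ha hN ε hy n d)).congr fun k => ?_
  simp only [Function.comp, Equiv.neg_apply]
  have : n * (N : ℤ) + d + 2 * N * -k = (n - 2 * k) * N + d := by ring
  rw [this]
  push_cast
  ring

theorem summable_halfSum (ha : 0 < a) (hN : a ^ 2 = 2 * N) (ε : ℂ) {y : ℝ} (hy : 0 < y)
    (n d : ℤ) : Summable fun k : ℕ => gauss a ε y ((n - 1 - 2 * k) * N + d) :=
  (summable_gauss_desc ha hN ε hy (n - 1) d).comp_injective Nat.cast_injective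

theorem summable_weightedHalfSum (ha : 0 < a) (hN : a ^ 2 = 2 * N) (ε : ℂ) {y : ℝ} (hy : 0 < y)
    (n d : ℤ) :
    Summable fun k : ℕ => ((k : ℂ) + 1) * gauss a ε y ((n - 2 - 2 * k) * N + d) := by
  simpa [Function.comp_def] using
    (summable_mul_gauss_desc ha hN ε hy (n - 2) d).comp_injective Nat.cast_injective

theorem halfSum_reflect (ha : 0 < a) (hN : a ^ 2 = 2 * N) (ε : ℂ) {y : ℝ} (hy : 0 < y)
    (n d : ℤ) :
    halfSum a N ε n d y
      = ∑' k : ℤ, gauss a ε y ((n - 1) * N + d + 2 * N * k) - halfSum a N (-ε) (-n) (-d) y := by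
  have h1 : ∀ k : ℕ, gauss a ε y ((n - 1 - 2 * (-((k : ℤ) + 1))) * N + d)
      = gauss a (-ε) y ((-n - 1 - 2 * k) * N + -d) := fun k => by
    rw [← gauss_neg (a := a) ε]
    congr 1
    ring
  have h2 : Summable fun k : ℕ => gauss a ε y ((n - 1 - 2 * (-((k : ℤ) + 1))) * N + d) :=
    (summable_halfSum ha hN (-ε) hy (-n) (-d)).congr fun k => (h1 k).symm
  have h3 := tsum_of_nat_of_neg_add_one
    (f := fun k : ℤ => gauss a ε y ((n - 1 - 2 * k) * N + d)) (summable_halfSum ha hN ε hy n d) h2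
  rw [tsum_congr h1] at h3
  rw [halfSum, halfSum, eq_sub_iff_add_eq, ← h3, ← (Equiv.neg ℤ).tsum_eq]
  refine tsum_congr fun k => ?_
  simp only [Equiv.neg_apply]
  congr 1
  ring

theorem weightedHalfSum_reflect (ha : 0 < a) (hN : a ^ 2 = 2 * N) (ε : ℂ) {y : ℝ} (hy : 0 < y)
    (n d : ℤ) :
    weightedHalfSum a N ε n d y
      = ((n * N + d) * ∑' k : ℤ, gauss a ε y ((n - 2) * N + d + 2 * N * k)
          - ∑' k : ℤ, (((n - 2) * N + d + 2 * N * k : ℤ) : ℂ)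
            * gauss a ε y ((n - 2) * N + d + 2 * N * k)) / (2 * N)
        + weightedHalfSum a N (-ε) (-n) (-d) y := by
  have hN0 : (N : ℂ) ≠ 0 := by exact_mod_cast ne_zero_of_sq_eq ha hN
  have h1 : ∀ k : ℕ, (((-((k : ℤ) + 1) : ℤ) : ℂ) + 1)
        * gauss a ε y ((n - 2 - 2 * (-((k : ℤ) + 1))) * N + d)
      = -((k : ℂ) * gauss a (-ε) y ((-n - 2 * k) * N + -d)) := fun k => by
    rw [← gauss_neg (a := a) ε]
    have : -((n - 2 - 2 * (-((k : ℤ) + 1))) * N + d) = (-n - 2 * k) * N + -d := by ring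
    rw [this]
    push_cast
    ring
  have h0 : Summable fun k : ℕ => (k : ℂ) * gauss a (-ε) y ((-n - 2 * k) * N + -d) := by
    rw [← summable_nat_add_iff 1]
    refine (summable_weightedHalfSum ha hN (-ε) hy (-n) (-d)).congr fun k => ?_
    push_cast
    congr 2
    ring
  have h4 : ∑' k : ℕ, (k : ℂ) * gauss a (-ε) y ((-n - 2 * k) * N + -d)
      = weightedHalfSum a N (-ε) (-n) (-d) y := by
    rw [h0.tsum_eq_zero_add, weightedHalfSum]
    simp only [Nat.cast_zero, zero_mul, zero_add]
    refine tsum_congr fun k => ?_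
    push_cast
    congr 2
    ring
  have h2 : Summable fun k : ℕ => (((-((k : ℤ) + 1) : ℤ) : ℂ) + 1)
        * gauss a ε y ((n - 2 - 2 * (-((k : ℤ) + 1))) * N + d) :=
    h0.neg.congr fun k => (h1 k).symm
  have h3 := tsum_of_nat_of_neg_add_one
    (f := fun k : ℤ => ((k : ℂ) + 1) * gauss a ε y ((n - 2 - 2 * k) * N + d))
    (by simpa using summable_weightedHalfSum ha hN ε hy n d) h2
  rw [tsum_congr h1, tsum_neg, h4] at h3
  have h5 : ∑' k : ℤ, ((k : ℂ) + 1) * gauss a ε y ((n - 2 - 2 * k) * N + d)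
      = ((n * N + d) * ∑' k : ℤ, gauss a ε y ((n - 2) * N + d + 2 * N * k)
          - ∑' k : ℤ, (((n - 2) * N + d + 2 * N * k : ℤ) : ℂ)
            * gauss a ε y ((n - 2) * N + d + 2 * N * k)) / (2 * N) := by
    have hs := summable_gauss ha hN ε hy ((n - 2) * N + d)
    have hs' : Summable fun k : ℤ => (((n - 2) * N + d + 2 * N * k : ℤ) : ℂ)
            * gauss a ε y ((n - 2) * N + d + 2 * N * k) := by
      refine ((hs.mul_left (((n - 2) * N + d : ℤ) : ℂ)).add
        ((summable_mul_gauss ha hN ε hy ((n - 2) * N + d)).mul_left (2 * N : ℂ))).congr fun k => ?_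
      push_cast
      ring
    rw [← tsum_mul_left, ← (hs.mul_left _).tsum_sub hs', ← tsum_div_const,
      ← (Equiv.neg ℤ).tsum_eq]
    refine tsum_congr fun k => ?_
    simp only [Equiv.neg_apply]
    have : (n - 2 - 2 * -k) * N + d = (n - 2) * N + d + 2 * N * k := by ring
    rw [this]
    push_cast
    field_simp
    ring
  rw [← h5, h3, weightedHalfSum]
  push_cast
  ring

end HalfSums

section HalfSums

variable {a : ℝ} {N : ℕ}

open Complex

/-- Either `Re ε > 0`, or `Re ε < 0` and `ε` is separated from the walls. -/
def Admissible (a : ℝ) (N : ℕ) (ε : ℂ) : Prop :=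
  0 < ε.re ∨ ε.re < 0 ∧ ∃ δ, 0 < δ ∧ WallGap a N ε δ

theorem modEq_two_of_even_sub {c c' : ℤ} (h : Even (c' - c)) : c ≡ c' [ZMOD 2] :=
  (Int.modEq_iff_dvd.mpr h.two_dvd)

theorem gauss_zero_sub_swap (ε : ℂ) (m : ℤ) :
    gauss a (-ε) 0 m = gauss a ε 0 (-m) := by
  rw [← gauss_neg (a := a) ε, neg_neg]

theorem tendsto_halfSum_sub (ha : 0 < a) (hN : a ^ 2 = 2 * N) {ε : ℂ} (hε : Admissible a N ε)
    (n v : ℤ) :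
    Tendsto (fun y => halfSum a N ε n v y - halfSum a N ε n (-v) y) (𝓝[>] 0)
      (𝓝 (gauss a ε 0 (n * N) * (gauss a ε 0 v - gauss a ε 0 (-v))
        / (gauss a ε 0 N - gauss a ε 0 (-N)))) := by
  have hN0 := ne_zero_of_sq_eq ha hN
  rcases hε with hpos | ⟨hneg, δ, hδ, hg⟩
  · convert! (tendsto_halfSum_of_pos ha hN0 hpos n v).sub
      (tendsto_halfSum_of_pos ha hN0 hpos n (-v)) using 2
    rw [gauss_zero_add, gauss_zero_add]
    ring
  · have hpos : 0 < (-ε).re := by simpa using hneg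
    have hfull := tendsto_tsum_gauss_sub ha hN hδ hg
      (c := (n - 1) * N + v) (c' := (n - 1) * N + -v)
      (modEq_two_of_even_sub ⟨-v, by ring⟩)
    have h := hfull.sub ((tendsto_halfSum_of_pos ha hN0 hpos (-n) (-v)).sub
      (tendsto_halfSum_of_pos ha hN0 hpos (-n) v))
    have hval : gauss a ε 0 (n * N) * (gauss a ε 0 v - gauss a ε 0 (-v))
        / (gauss a ε 0 N - gauss a ε 0 (-N))
        = 0 - (gauss a (-ε) 0 (-n * N + -v) / (gauss a (-ε) 0 N - gauss a (-ε) 0 (-N))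
          - gauss a (-ε) 0 (-n * N + v) / (gauss a (-ε) 0 N - gauss a (-ε) 0 (-N))) := by
      simp only [gauss_zero_sub_swap, gauss_zero_add, neg_neg, neg_mul]
      rw [← neg_sub (gauss a ε 0 (N : ℤ)) (gauss a ε 0 (-(N : ℤ))), div_neg, div_neg]
      ring
    rw [hval]
    refine h.congr' ?_
    filter_upwards [self_mem_nhdsWithin] with y hy
    rw [halfSum_reflect ha hN ε hy n v, halfSum_reflect ha hN ε hy n (-v), neg_neg]
    ring

theorem tendsto_weightedHalfSum_combination (ha : 0 < a) (hN : a ^ 2 = 2 * N) {ε : ℂ}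
    (hε : Admissible a N ε) (n u v : ℤ) :
    Tendsto (fun y => weightedHalfSum a N ε n (u + v) y + weightedHalfSum a N ε n (-u - v) y
        - weightedHalfSum a N ε n (-u + v) y - weightedHalfSum a N ε n (u - v) y) (𝓝[>] 0)
      (𝓝 (gauss a ε 0 (n * N) * ((gauss a ε 0 u - gauss a ε 0 (-u))
        * (gauss a ε 0 v - gauss a ε 0 (-v))) / (gauss a ε 0 N - gauss a ε 0 (-N)) ^ 2)) := by
  have hN0 := ne_zero_of_sq_eq ha hN
  rcases hε with hpos | ⟨hneg, δ, hδ, hg⟩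
  · have hl := tendsto_weightedHalfSum_of_pos ha hN0 hpos n
    convert! (((hl (u + v)).add (hl (-u - v))).sub (hl (-u + v))).sub (hl (u - v)) using 2
    simp only [gauss_zero_add, sub_eq_add_neg]
    ring
  · have hpos : 0 < (-ε).re := by simpa using hneg
    have hl := tendsto_weightedHalfSum_of_pos ha hN0 hpos (-n)
    have h0 : ∀ d d' : ℤ, Even (d' - d) → _ := fun d d' h =>
      tendsto_tsum_gauss_sub ha hN hδ hg (c := (n - 2) * N + d) (c' := (n - 2) * N + d')
      (modEq_two_of_even_sub (by simpa using h))
    have h1 : ∀ d d' : ℤ, Even (d' - d) → _ := fun d d' h =>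
      tendsto_tsum_mul_gauss_sub ha hN hδ hg (c := (n - 2) * N + d) (c' := (n - 2) * N + d')
      (modEq_two_of_even_sub (by simpa using h))
    have e1 : Even ((-u + v) - (u + v)) := ⟨-u, by ring⟩
    have e2 : Even ((u - v) - (-u - v)) := ⟨u, by ring⟩
    have e3 : Even ((-u - v) - (u + v)) := ⟨-u - v, by ring⟩
    have e4 : Even ((u - v) - (-u + v)) := ⟨u - v, by ring⟩
    have hfull := ((((((h0 _ _ e1).add (h0 _ _ e2)).const_mul ((n : ℂ) * N)).add
      ((h0 _ _ e3).const_mul ((u : ℂ) + v))).sub ((h0 _ _ e4).const_mul (-(u : ℂ) + v))).sub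
      ((h1 _ _ e1).add (h1 _ _ e2))).div_const (2 * N : ℂ)
    have h := hfull.add ((((hl (-(u + v))).add (hl (-(-u - v)))).sub (hl (-(-u + v)))).sub
      (hl (-(u - v))))
    have hval : gauss a ε 0 (n * N) * ((gauss a ε 0 u - gauss a ε 0 (-u))
        * (gauss a ε 0 v - gauss a ε 0 (-v))) / (gauss a ε 0 N - gauss a ε 0 (-N)) ^ 2
        = ((n : ℂ) * N * (0 + 0) + (u + v) * 0 - (-u + v) * 0 - (0 + 0)) / (2 * N)
        + (gauss a (-ε) 0 (-n * N + -(u + v)) / (gauss a (-ε) 0 N - gauss a (-ε) 0 (-N)) ^ 2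
        + gauss a (-ε) 0 (-n * N + -(-u - v)) / (gauss a (-ε) 0 N - gauss a (-ε) 0 (-N)) ^ 2
        - gauss a (-ε) 0 (-n * N + -(-u + v)) / (gauss a (-ε) 0 N - gauss a (-ε) 0 (-N)) ^ 2
        - gauss a (-ε) 0 (-n * N + -(u - v)) / (gauss a (-ε) 0 N - gauss a (-ε) 0 (-N)) ^ 2) := by
      simp only [gauss_zero_sub_swap, gauss_zero_add, neg_neg, neg_mul, neg_add_rev, sub_eq_add_neg]
      rw [show (gauss a ε 0 (N : ℤ) + -gauss a ε 0 (-(N : ℤ))) ^ 2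
        = (gauss a ε 0 (-(N : ℤ)) + -gauss a ε 0 (N : ℤ)) ^ 2 by ring]
      ring
    rw [hval]
    refine h.congr' ?_
    filter_upwards [self_mem_nhdsWithin] with y hy
    simp only [weightedHalfSum_reflect ha hN ε hy n]
    push_cast
    ring

/-- Differences of full Gaussian sums vanish in the limit at `ε = 0`. -/
theorem tendsto_tsum_gauss_sub_zero (ha : 0 < a) (hN : a ^ 2 = 2 * N) {c c' : ℤ}
    (hc : c ≡ c' [ZMOD 2]) :
    Tendsto (fun y : ℝ => ∑' k : ℤ, (gauss a 0 y (c + 2 * N * k) - gauss a 0 y (c' + 2 * N * k)))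
      (𝓝[>] 0) (𝓝 0) := by
  have hg : WallGap a N 0 (1 / a ^ 2) := by
    intro j hj
    have hj0 : j ≠ 0 := by rintro rfl; simp at hj
    have h1 : (1 : ℝ) ≤ (j : ℝ) ^ 2 := by
      have h2 : 1 ≤ j ^ 2 := by nlinarith [sq_abs j, Int.one_le_abs hj0]
      exact_mod_cast h2
    simp only [zero_im, zero_re, zero_sub, neg_sq, div_pow]
    rw [zero_pow two_ne_zero, sub_zero]
    gcongr
  refine (tendsto_tsum_gauss_sub ha hN (by positivity) hg hc).congr' ?_
  filter_upwards [self_mem_nhdsWithin] with y hy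
  exact ((summable_gauss ha hN 0 hy c).tsum_sub (summable_gauss ha hN 0 hy c')).symm

end HalfSums

section Characters

variable {p q : ℕ}

open Complex

theorem alpha_pos (hp : 2 ≤ p) (hq : 2 ≤ q) : 0 < alpha p q := by
  have : (0 : ℝ) < p := by positivity
  have : (0 : ℝ) < q := by positivity
  exact Real.sqrt_pos.mpr (by positivity)

theorem alpha_sq (p q : ℕ) : alpha p q ^ 2 = 2 * (p * q : ℕ) := by
  rw [alpha, Real.sq_sqrt (by positivity)]
  push_cast
  ring

theorem sqrt_two_mul_div (hp : 2 ≤ p) (hq : 2 ≤ q) :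
    Real.sqrt (2 * q / p) = 2 * q / alpha p q := by
  have h0 : (0 : ℝ) < p := by positivity
  have h1 := alpha_pos hp hq
  rw [eq_div_iff h1.ne', alpha, ← Real.sqrt_mul (by positivity)]
  have : (2 * (q : ℝ) / p * (2 * p * q)) = (2 * q) ^ 2 := by field_simp
  rw [this, Real.sqrt_sq (by positivity)]

theorem alpha_comm (p q : ℕ) : alpha p q = alpha q p := by
  rw [alpha, alpha]; congr 1; ring

theorem sqrt_two_mul_div' (hp : 2 ≤ p) (hq : 2 ≤ q) :
    Real.sqrt (2 * p / q) = 2 * p / alpha p q := by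
  rw [sqrt_two_mul_div hq hp, alpha_comm]

theorem alphaRS_sub (hp : 2 ≤ p) (hq : 2 ≤ q) (r s n : ℤ) :
    (alphaRS p q r s n : ℂ) - (alphaZero p q : ℂ) / 2
      = ((n * (p * q : ℕ) - r * q + s * p : ℤ) : ℂ) / alpha p q := by
  have h1 := alpha_pos hp hq
  have h2 := alpha_sq p q
  have : alphaRS p q r s n - alphaZero p q / 2
      = ((n * (p * q : ℕ) - r * q + s * p : ℤ) : ℝ) / alpha p q := by
    rw [alphaRS, alphaZero, alphaPlus, alphaMinus, sqrt_two_mul_div hp hq, sqrt_two_mul_div' hp hq]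
    push_cast at h2 ⊢
    field_simp
    rw [h2]
    ring
  exact_mod_cast this

theorem chF_eq (lam ε : ℂ) {y : ℝ} (hy : 0 < y) :
    chF p q lam ε (I * y) = cexp (2 * Real.pi * ε * (lam - (alphaZero p q : ℂ) / 2)
      - Real.pi * y * (lam - (alphaZero p q : ℂ) / 2) ^ 2) * fockSum y := by
  rw [chF, chFock_eq p q lam hy, ← mul_assoc, ← Complex.exp_add, ← sub_eq_add_neg]

theorem chFrs_eq (hp : 2 ≤ p) (hq : 2 ≤ q) (r s n : ℤ) (ε : ℂ) {y : ℝ} (hy : 0 < y) :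
    chFrs p q r s n ε (I * y)
      = gauss (alpha p q) ε y (n * (p * q : ℕ) - r * q + s * p) * fockSum y := by
  rw [chFrs, chF_eq _ _ hy, alphaRS_sub hp hq, gauss]

theorem chFock_alphaRS (hp : 2 ≤ p) (hq : 2 ≤ q) (r s n : ℤ) {y : ℝ} (hy : 0 < y) :
    chFock p q (alphaRS p q r s n : ℂ) (I * y)
      = gauss (alpha p q) 0 y (n * (p * q : ℕ) - r * q + s * p) * fockSum y := by
  rw [← chFrs_eq hp hq r s n 0 hy, chFrs, chF]
  simp

theorem tendsto_chVir (hp : 2 ≤ p) (hq : 2 ≤ q) (r s : ℤ) :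
    Tendsto (fun y : ℝ => chVir p q r s (I * y) / fockSum y) (𝓝[>] 0) (𝓝 0) := by
  have h := tendsto_tsum_gauss_sub_zero (alpha_pos hp hq) (alpha_sq p q)
    (c := -r * q + s * p) (c' := r * q + s * p) (modEq_two_of_even_sub ⟨r * q, by ring⟩)
  refine h.congr' ?_
  filter_upwards [self_mem_nhdsWithin] with y hy
  have hf : (fockSum y : ℂ) ≠ 0 := by exact_mod_cast fockSum_ne_zero hy
  rw [eq_div_iff hf, chVir, ← tsum_mul_right]
  refine tsum_congr fun k => ?_
  rw [chFock_alphaRS hp hq _ _ _ hy, chFock_alphaRS hp hq _ _ _ hy, ← sub_mul]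
  congr 3 <;> (push_cast; ring)

theorem chIint_tsum (hp : 2 ≤ p) (hq : 2 ≤ q) (r s n : ℤ) (ε : ℂ) {y : ℝ} (hy : 0 < y) :
    ∑' k : ℕ, ((k : ℂ) + 1) *
      (chFrs p q (p - r) s (n - 2 * k - 1) ε (I * y) + chFrs p q r (q - s) (n - 2 * k - 3) ε (I * y)
        - chFrs p q r s (n - 2 * k - 2) ε (I * y)
        - chFrs p q (p - r) (q - s) (n - 2 * k - 2) ε (I * y))
      = (weightedHalfSum (alpha p q) (p * q) ε n (r * q + s * p) y
          + weightedHalfSum (alpha p q) (p * q) ε n (-(r * q) - s * p) y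
          - weightedHalfSum (alpha p q) (p * q) ε n (-(r * q) + s * p) y
          - weightedHalfSum (alpha p q) (p * q) ε n (r * q - s * p) y) * fockSum y := by
  have hs := summable_weightedHalfSum (alpha_pos hp hq) (alpha_sq p q) ε hy n
  simp only [weightedHalfSum]
  rw [← (hs _).tsum_add (hs _), ← ((hs _).add (hs _)).tsum_sub (hs _),
    ← (((hs _).add (hs _)).sub (hs _)).tsum_sub (hs _), ← tsum_mul_right]
  refine tsum_congr fun k => ?_
  simp only [chFrs_eq hp hq _ _ _ ε hy]
  rw [show (n - 2 * k - 1) * ((p * q : ℕ) : ℤ) - (p - r) * q + s * p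
      = (n - 2 - 2 * k) * ((p * q : ℕ) : ℤ) + (r * q + s * p) by push_cast; ring,
    show (n - 2 * k - 3) * ((p * q : ℕ) : ℤ) - r * q + (q - s) * p
      = (n - 2 - 2 * k) * ((p * q : ℕ) : ℤ) + (-(r * q) - s * p) by push_cast; ring,
    show (n - 2 * k - 2) * ((p * q : ℕ) : ℤ) - r * q + s * p
      = (n - 2 - 2 * k) * ((p * q : ℕ) : ℤ) + (-(r * q) + s * p) by push_cast; ring,
    show (n - 2 * k - 2) * ((p * q : ℕ) : ℤ) - (p - r) * q + (q - s) * p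
      = (n - 2 - 2 * k) * ((p * q : ℕ) : ℤ) + (r * q - s * p) by push_cast; ring]
  ring

theorem chIplus_tsum (hp : 2 ≤ p) (hq : 2 ≤ q) (r n : ℤ) (ε : ℂ) {y : ℝ} (hy : 0 < y) :
    ∑' k : ℕ, (chFrs p q (p - r) q (n - 2 * k - 1) ε (I * y)
        - chFrs p q r q (n - 2 * k - 2) ε (I * y))
      = (halfSum (alpha p q) (p * q) ε n (r * q) y
          - halfSum (alpha p q) (p * q) ε n (-(r * q)) y) * fockSum y := by
  have hs := summable_halfSum (alpha_pos hp hq) (alpha_sq p q) ε hy n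
  simp only [halfSum]
  rw [← (hs _).tsum_sub (hs _), ← tsum_mul_right]
  refine tsum_congr fun k => ?_
  simp only [chFrs_eq hp hq _ _ _ ε hy]
  rw [show (n - 2 * k - 1) * ((p * q : ℕ) : ℤ) - (p - r) * q + q * p
      = (n - 1 - 2 * k) * ((p * q : ℕ) : ℤ) + r * q by push_cast; ring,
    show (n - 2 * k - 2) * ((p * q : ℕ) : ℤ) - r * q + q * p
      = (n - 1 - 2 * k) * ((p * q : ℕ) : ℤ) + -(r * q) by push_cast; ring]
  ring

theorem chIminus_tsum (hp : 2 ≤ p) (hq : 2 ≤ q) (s n : ℤ) (ε : ℂ) {y : ℝ} (hy : 0 < y) :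
    ∑' k : ℕ, (chFrs p q p s (n - 2 * k) ε (I * y)
        - chFrs p q p (q - s) (n - 2 * k - 1) ε (I * y))
      = (halfSum (alpha p q) (p * q) ε n (s * p) y
          - halfSum (alpha p q) (p * q) ε n (-(s * p)) y) * fockSum y := by
  have hs := summable_halfSum (alpha_pos hp hq) (alpha_sq p q) ε hy n
  simp only [halfSum]
  rw [← (hs _).tsum_sub (hs _), ← tsum_mul_right]
  refine tsum_congr fun k => ?_
  simp only [chFrs_eq hp hq _ _ _ ε hy]
  rw [show (n - 2 * k) * ((p * q : ℕ) : ℤ) - p * q + s * p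
      = (n - 1 - 2 * k) * ((p * q : ℕ) : ℤ) + s * p by push_cast; ring,
    show (n - 2 * k - 1) * ((p * q : ℕ) : ℤ) - p * q + (q - s) * p
      = (n - 1 - 2 * k) * ((p * q : ℕ) : ℤ) + -(s * p) by push_cast; ring]
  ring

/-- The limit of `ch[I_{r,s;n}^ε] / ch[F_{α₀/2}]` as `y → 0`. -/
def limI (p q : ℕ) (r s n : ℤ) (ε : ℂ) : ℂ :=
  gauss (alpha p q) ε 0 (n * (p * q : ℕ))
    * ((gauss (alpha p q) ε 0 (r * q) - gauss (alpha p q) ε 0 (-(r * q)))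
      * (gauss (alpha p q) ε 0 (s * p) - gauss (alpha p q) ε 0 (-(s * p))))
    / (gauss (alpha p q) ε 0 (p * q : ℕ) - gauss (alpha p q) ε 0 (-(p * q : ℕ))) ^ 2

theorem admissible_of_mem_region {ε : ℂ} (hε : ε ∈ region p q) :
    Admissible (alpha p q) (p * q) ε := by
  rcases lt_or_gt_of_ne hε.2 with hneg | hpos
  · refine Or.inr ⟨hneg, wall p q ε ^ 2 - ε.re ^ 2, ?_, ?_⟩
    · nlinarith [hε.1]
    · intro j hj
      have hb : BddBelow {x : ℝ | ∃ m : ℤ, ¬ ((p * q : ℕ) : ℤ) ∣ m ∧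
          x = |(m : ℝ) / alpha p q - ε.im|} := ⟨0, by rintro x ⟨m, -, rfl⟩; exact abs_nonneg _⟩
      have h1 := csInf_le hb ⟨j, hj, rfl⟩
      have h2 : -wall p q ε ≤ |(j : ℝ) / alpha p q - ε.im| := by
        rw [wall, neg_neg]; exact h1
      have h3 : (ε.im - j / alpha p q) ^ 2 = |(j : ℝ) / alpha p q - ε.im| ^ 2 := by
        rw [sq_abs]; ring
      rw [h3]
      have h4 : 0 < -wall p q ε := by linarith [hε.1]
      nlinarith
  · exact Or.inl hpos

theorem wall_nonpos (ε : ℂ) : wall p q ε ≤ 0 := by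
  rw [wall, neg_nonpos]
  exact Real.sInf_nonneg (by rintro x ⟨m, -, rfl⟩; exact abs_nonneg _)

theorem tendsto_chI (hp : 2 ≤ p) (hq : 2 ≤ q) (r s n : ℤ) {ε : ℂ} (hε : ε ∈ region p q) :
    Tendsto (fun y : ℝ => chI p q r s n ε (I * y) / fockSum y) (𝓝[>] 0) (𝓝 (limI p q r s n ε)) := by
  have ha := alpha_pos hp hq
  have hN := alpha_sq p q
  have hadm := admissible_of_mem_region hε
  have hden : gauss (alpha p q) ε 0 (p * q : ℕ) - gauss (alpha p q) ε 0 (-(p * q : ℕ)) ≠ 0 := by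
    refine gauss_zero_sub_ne_zero ha ?_ hε.2
    exact_mod_cast ne_zero_of_sq_eq ha hN
  have hf : ∀ᶠ y in 𝓝[>] (0 : ℝ), (fockSum y : ℂ) ≠ 0 := by
    filter_upwards [self_mem_nhdsWithin] with y hy
    exact_mod_cast fockSum_ne_zero hy
  have hpq : ((p : ℤ) * q) = (p * q : ℕ) := by push_cast; rfl
  have hqp : ((q : ℤ) * p) = (p * q : ℕ) := by push_cast; ring
  by_cases hr : r = p
  · by_cases hs : s = q
    · subst hr hs
      have : limI p q p q n ε = gauss (alpha p q) ε 0 (n * (p * q : ℕ)) := by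
        rw [limI, hpq, hqp]
        field_simp
      rw [this]
      refine (tendsto_gauss ε _).congr' ?_
      filter_upwards [self_mem_nhdsWithin, hf] with y hy hfy
      rw [chI, if_pos rfl, if_pos rfl, chFrs_eq hp hq _ _ _ _ hy, mul_div_cancel_right₀ _ hfy]
      congr 1
      ring
    · subst hr
      have : limI p q p s n ε = gauss (alpha p q) ε 0 (n * (p * q : ℕ))
          * (gauss (alpha p q) ε 0 (s * p) - gauss (alpha p q) ε 0 (-(s * p)))
          / (gauss (alpha p q) ε 0 (p * q : ℕ) - gauss (alpha p q) ε 0 (-(p * q : ℕ))) := by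
        rw [limI, hpq]
        field_simp
      rw [this]
      refine (tendsto_halfSum_sub ha hN hadm n (s * p)).congr' ?_
      filter_upwards [self_mem_nhdsWithin, hf] with y hy hfy
      rw [chI, if_pos rfl, if_neg hs, chIminus, if_neg (by simp), zero_add,
        chIminus_tsum hp hq _ _ _ hy, mul_div_cancel_right₀ _ hfy]
  · by_cases hs : s = q
    · subst hs
      have : limI p q r q n ε = gauss (alpha p q) ε 0 (n * (p * q : ℕ))
          * (gauss (alpha p q) ε 0 (r * q) - gauss (alpha p q) ε 0 (-(r * q)))
          / (gauss (alpha p q) ε 0 (p * q : ℕ) - gauss (alpha p q) ε 0 (-(p * q : ℕ))) := by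
        rw [limI, hqp]
        field_simp
      rw [this]
      refine (tendsto_halfSum_sub ha hN hadm n (r * q)).congr' ?_
      filter_upwards [self_mem_nhdsWithin, hf] with y hy hfy
      rw [chI, if_neg hr, if_pos rfl, chIplus, if_neg (by simp), zero_add,
        chIplus_tsum hp hq _ _ _ hy, mul_div_cancel_right₀ _ hfy]
    · have hV : Tendsto (fun y : ℝ => (if 0 ≤ n then (n : ℂ) * (if Even n then
          chVir p q r s (I * y) else -chVir p q r (q - s) (I * y)) else 0) / fockSum y)
          (𝓝[>] 0) (𝓝 0) := by
        split_ifs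
        · simpa [mul_div_assoc] using (tendsto_chVir hp hq r s).const_mul (n : ℂ)
        · simpa [mul_div_assoc, neg_div] using (tendsto_chVir hp hq r (q - s)).neg.const_mul (n : ℂ)
        · simp
      have h := hV.add (tendsto_weightedHalfSum_combination ha hN hadm n (r * q) (s * p))
      rw [zero_add, ← limI] at h
      refine h.congr' ?_
      filter_upwards [self_mem_nhdsWithin, hf] with y hy hfy
      rw [chI, if_neg hr, if_neg hs, chIint, chIint_tsum hp hq _ _ _ _ hy, add_div _ (_ * _),
        mul_div_cancel_right₀ _ hfy]

theorem tendsto_chVac (hp : 2 ≤ p) (hq : 2 ≤ q) {ε : ℂ} (hε : ε ∈ region p q) :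
    Tendsto (fun y : ℝ => chVac p q ε (I * y) / fockSum y) (𝓝[>] 0)
      (𝓝 (limI p q 1 1 0 ε)) := by
  simpa [chVac, add_div] using (tendsto_chVir hp hq 1 1).add (tendsto_chI hp hq 1 1 0 hε)

theorem tendsto_chF (lam ε : ℂ) :
    Tendsto (fun y : ℝ => chF p q (lam + (alphaZero p q : ℂ) / 2) ε (I * y) / fockSum y) (𝓝[>] 0)
      (𝓝 (cexp (2 * Real.pi * lam * ε))) := by
  have : Continuous fun y : ℝ => cexp (2 * Real.pi * ε * lam - Real.pi * y * lam ^ 2) := by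
    fun_prop
  have h := (this.tendsto 0).mono_left (nhdsWithin_le_nhds (s := Set.Ioi 0))
  have hv : 2 * Real.pi * ε * lam - Real.pi * ((0 : ℝ) : ℂ) * lam ^ 2 = 2 * Real.pi * lam * ε := by
    push_cast; ring
  rw [hv] at h
  refine h.congr' ?_
  filter_upwards [self_mem_nhdsWithin] with y hy
  have hf : (fockSum y : ℂ) ≠ 0 := by exact_mod_cast fockSum_ne_zero hy
  rw [chF_eq _ _ hy, mul_div_cancel_right₀ _ hf, add_sub_cancel_right]

/-- Quotients of characters may be computed after division by `fockSum`. -/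
theorem tendsto_div_of_fockSum {f g : ℝ → ℂ} {u v : ℂ} (hv : v ≠ 0)
    (hf : Tendsto (fun y => f y / fockSum y) (𝓝[>] 0) (𝓝 u))
    (hg : Tendsto (fun y => g y / fockSum y) (𝓝[>] 0) (𝓝 v)) :
    Tendsto (fun y => f y / g y) (𝓝[>] 0) (𝓝 (u / v)) := by
  refine (hf.div hg hv).congr' ?_
  filter_upwards [self_mem_nhdsWithin] with y hy
  have h : (fockSum y : ℂ) ≠ 0 := by exact_mod_cast fockSum_ne_zero hy
  simp only [Pi.div_apply]
  exact div_div_div_cancel_right₀ h _ _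

/-- Passing from `τ = iy`, `y → 0⁺` to `τ = -1/iy`, `y → +∞`. -/
theorem tendsto_modular {f : ℂ → ℂ} {l : Filter ℂ}
    (h : Tendsto (fun y : ℝ => f (I * y)) (𝓝[>] 0) l) :
    Tendsto (fun y : ℝ => f (-1 / (I * y))) atTop l := by
  refine (h.comp tendsto_inv_atTop_nhdsGT_zero).congr fun y => ?_
  simp only [Function.comp]
  congr 1
  push_cast
  rw [div_mul_eq_div_div, neg_div, one_div, inv_I, neg_neg, div_eq_mul_inv]

end Characters

section Values

variable {p q : ℕ}

open Complex

theorem gauss_zero_sub_eq_sin (a : ℝ) (ε : ℂ) (m : ℤ) :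
    gauss a ε 0 m - gauss a ε 0 (-m) = -(2 * I) * Complex.sin (I * (2 * Real.pi * (m / a) * ε)) := by
  have h1 : (2 * Real.pi * ε * (m / a) - Real.pi * ((0 : ℝ) : ℂ) * (m / a) ^ 2 : ℂ)
      = 2 * Real.pi * (m / a) * ε := by push_cast; ring
  have h2 : (2 * Real.pi * ε * (((-m : ℤ) : ℂ) / a)
      - Real.pi * ((0 : ℝ) : ℂ) * (((-m : ℤ) : ℂ) / a) ^ 2 : ℂ)
      = -(2 * Real.pi * (m / a) * ε) := by push_cast; ring
  rw [gauss, gauss, h1, h2, mul_comm I, Complex.sin_mul_I, Complex.sinh]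
  ring_nf
  simp only [I_sq]
  ring

theorem limI_eq (hp : 2 ≤ p) (hq : 2 ≤ q) (r s n : ℤ) (ε : ℂ) :
    limI p q r s n ε = cexp ((Real.sqrt (2 * p * q) : ℂ) * Real.pi * n * ε)
      * (Complex.sin (I * r * Real.pi * (Real.sqrt (2 * q / p) : ℂ) * ε)
        * Complex.sin (I * s * Real.pi * (Real.sqrt (2 * p / q) : ℂ) * ε))
      / Complex.sin (I * Real.pi * (Real.sqrt (2 * p * q) : ℂ) * ε) ^ 2 := by
  have ha : (alpha p q : ℂ) ≠ 0 := by exact_mod_cast (alpha_pos hp hq).ne'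
  have hsq : (alpha p q : ℂ) ^ 2 = 2 * (p * q) := by exact_mod_cast alpha_sq p q
  have h1 : (I * (2 * Real.pi * (((r * q : ℤ) : ℂ) / alpha p q) * ε))
      = I * r * Real.pi * (Real.sqrt (2 * q / p) : ℂ) * ε := by
    rw [sqrt_two_mul_div hp hq]; push_cast; ring
  have h2 : (I * (2 * Real.pi * (((s * p : ℤ) : ℂ) / alpha p q) * ε))
      = I * s * Real.pi * (Real.sqrt (2 * p / q) : ℂ) * ε := by
    rw [sqrt_two_mul_div' hp hq]; push_cast; ring
  have h3 : (I * (2 * Real.pi * ((((p * q : ℕ) : ℤ) : ℂ) / alpha p q) * ε))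
      = I * Real.pi * (Real.sqrt (2 * p * q) : ℂ) * ε := by
    rw [← alpha]
    push_cast
    field_simp
    rw [hsq]
    ring
  have h4 : gauss (alpha p q) ε 0 (n * (p * q : ℕ))
      = cexp ((Real.sqrt (2 * p * q) : ℂ) * Real.pi * n * ε) := by
    rw [gauss, ← alpha]
    congr 1
    push_cast
    field_simp
    rw [show (alpha p q : ℂ) ^ 3 = (alpha p q : ℂ) ^ 2 * alpha p q by ring, hsq]
    ring
  rw [limI, gauss_zero_sub_eq_sin, gauss_zero_sub_eq_sin, gauss_zero_sub_eq_sin, h1, h2, h3, h4]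
  have h5 : (-(2 * I)) ^ 2 ≠ 0 := pow_ne_zero _ (neg_ne_zero.mpr (mul_ne_zero two_ne_zero I_ne_zero))
  rw [mul_pow, ← mul_div_mul_left _ (_ ^ 2) h5]
  congr 1
  ring

theorem limI_ne_zero (hp : 2 ≤ p) (hq : 2 ≤ q) {ε : ℂ} (hε : ε.re ≠ 0) :
    limI p q 1 1 0 ε ≠ 0 := by
  have ha := alpha_pos hp hq
  rw [limI]
  refine div_ne_zero (mul_ne_zero (Complex.exp_ne_zero _) (mul_ne_zero ?_ ?_)) (pow_ne_zero _ ?_)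
  all_goals
    refine gauss_zero_sub_ne_zero ha ?_ hε
    norm_cast
    positivity

theorem limI_div (hp : 2 ≤ p) (hq : 2 ≤ q) (r s n : ℤ) {ε : ℂ} (hε : ε.re ≠ 0) :
    limI p q r s n ε / limI p q 1 1 0 ε = atypicalValue p q r s n ε := by
  have h := limI_ne_zero hp hq hε
  rw [limI_eq hp hq] at h
  have h0 := (div_ne_zero_iff.mp h).2
  rw [limI_eq hp hq, limI_eq hp hq, div_div_div_cancel_right₀ h0, atypicalValue]
  simp

theorem exp_div_limI (hp : 2 ≤ p) (hq : 2 ≤ q) (lam ε : ℂ) :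
    cexp (2 * Real.pi * lam * ε) / limI p q 1 1 0 ε = typicalValue p q lam ε := by
  rw [limI_eq hp hq, typicalValue, div_div_eq_mul_div]
  simp only [Int.cast_one, Int.cast_zero, mul_zero, zero_mul, Complex.exp_zero, mul_one, one_mul]
  rw [mul_comm (Complex.sin (I * Real.pi * (Real.sqrt (2 * q / p) : ℂ) * ε)), sq]

theorem sKernel_zero (hp : 2 ≤ p) (hq : 2 ≤ q) (r s n : ℤ) (ε : ℂ) :
    sKernel p q r s n ε 0 = -limI p q r s n ε := by
  have ha : (alpha p q : ℂ) ≠ 0 := by exact_mod_cast (alpha_pos hp hq).ne'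
  have h1 : (2 * Real.pi * r * q * ((((0 : ℝ) : ℂ) + I * ε) / (alpha p q : ℂ)))
      = I * r * Real.pi * (Real.sqrt (2 * q / p) : ℂ) * ε := by
    rw [sqrt_two_mul_div hp hq]; push_cast; ring
  have h2 : (2 * Real.pi * s * p * ((((0 : ℝ) : ℂ) + I * ε) / (alpha p q : ℂ)))
      = I * s * Real.pi * (Real.sqrt (2 * p / q) : ℂ) * ε := by
    rw [sqrt_two_mul_div' hp hq]; push_cast; ring
  have h3 : (Real.pi * (alpha p q : ℂ) * (((0 : ℝ) : ℂ) + I * ε))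
      = I * Real.pi * (Real.sqrt (2 * p * q) : ℂ) * ε := by
    rw [alpha]; push_cast; ring
  have h4 : -(Real.pi * I * n * (alpha p q : ℂ) * (((0 : ℝ) : ℂ) + I * ε))
      = (Real.sqrt (2 * p * q) : ℂ) * Real.pi * n * ε := by
    rw [alpha]; push_cast; ring_nf; simp only [I_sq]; ring
  have h5 : cexp (-(2 * Real.pi * ε * ((0 : ℝ) : ℂ))) = 1 := by simp
  rw [sKernel, h1, h2, h3, h4, h5, limI_eq hp hq]
  ring

theorem sKernel_div (hp : 2 ≤ p) (hq : 2 ≤ q) (r s n : ℤ) {ε : ℂ} (hε : ε.re ≠ 0) :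
    sKernel p q r s n ε 0 / sKernel p q 1 1 0 ε 0 = atypicalValue p q r s n ε := by
  rw [sKernel_zero hp hq, sKernel_zero hp hq, neg_div_neg_eq, limI_div hp hq r s n hε]

theorem tendsto_sin_div (c : ℂ) :
    Tendsto (fun ε : ℂ => Complex.sin (c * ε) / ε) (𝓝[≠] 0) (𝓝 c) := by
  have h : HasDerivAt (fun ε : ℂ => Complex.sin (c * ε)) c 0 := by
    simpa using ((hasDerivAt_id (0 : ℂ)).const_mul c).csin
  refine (hasDerivAt_iff_tendsto_slope.mp h).congr fun ε => ?_
  simp [slope_def_field]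

theorem tendsto_sin_mul_div_sin_mul (b c d e : ℂ) (hd : d ≠ 0) (he : e ≠ 0) :
    Tendsto (fun ε : ℂ => Complex.sin (b * ε) * Complex.sin (c * ε)
      / (Complex.sin (d * ε) * Complex.sin (e * ε))) (𝓝[≠] 0) (𝓝 (b * c / (d * e))) := by
  refine (((tendsto_sin_div b).mul (tendsto_sin_div c)).div
    ((tendsto_sin_div d).mul (tendsto_sin_div e)) (mul_ne_zero hd he)).congr' ?_
  filter_upwards [self_mem_nhdsWithin] with ε hε
  have hε' : ε ≠ 0 := hε
  simp only [Pi.div_apply]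
  rw [div_mul_div_comm, div_mul_div_comm, div_div_div_cancel_right₀ (mul_ne_zero hε' hε')]

theorem sqrt_ne_zero (hp : 2 ≤ p) (hq : 2 ≤ q) : (Real.sqrt (2 * p / q) : ℂ) ≠ 0 := by
  have h0 : (0 : ℝ) < p := by positivity
  have h1 : (0 : ℝ) < q := by positivity
  exact_mod_cast (Real.sqrt_pos.mpr (by positivity : (0 : ℝ) < 2 * p / q)).ne'

theorem tendsto_typicalValue (hp : 2 ≤ p) (hq : 2 ≤ q) (lam : ℂ) :
    Tendsto (typicalValue p q lam) (𝓝[≠] 0) (𝓝 ((p : ℂ) * q)) := by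
  have hpi : (Real.pi : ℂ) ≠ 0 := by exact_mod_cast Real.pi_ne_zero
  have hne : ∀ x : ℂ, x ≠ 0 → I * Real.pi * x ≠ 0 := fun x hx =>
    mul_ne_zero (mul_ne_zero I_ne_zero hpi) hx
  have ha : (alpha p q : ℂ) ≠ 0 := by exact_mod_cast (alpha_pos hp hq).ne'
  have hsq : (alpha p q : ℂ) ^ 2 = 2 * (p * q) := by exact_mod_cast alpha_sq p q
  have hp' : (p : ℂ) ≠ 0 := by exact_mod_cast (by omega : p ≠ 0)
  have hq' : (q : ℂ) ≠ 0 := by exact_mod_cast (by omega : q ≠ 0)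
  have h := tendsto_sin_mul_div_sin_mul (I * Real.pi * (Real.sqrt (2 * p * q) : ℂ))
    (I * Real.pi * (Real.sqrt (2 * p * q) : ℂ)) _ _ (hne _ (sqrt_ne_zero hp hq))
    (hne _ (sqrt_ne_zero hq hp))
  have hE : Tendsto (fun ε : ℂ => cexp (2 * Real.pi * lam * ε)) (𝓝[≠] 0) (𝓝 1) := by
    have : Continuous fun ε : ℂ => cexp (2 * Real.pi * lam * ε) := by fun_prop
    simpa using (this.tendsto 0).mono_left nhdsWithin_le_nhds
  convert! hE.mul h using 2
  · rw [typicalValue, mul_div_assoc]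
  · rw [sqrt_two_mul_div hp hq, sqrt_two_mul_div' hp hq, ← alpha]
    push_cast
    field_simp
    rw [show (alpha p q : ℂ) ^ 4 = (alpha p q : ℂ) ^ 2 * (alpha p q : ℂ) ^ 2 by ring, hsq]
    ring

theorem tendsto_atypicalValue (hp : 2 ≤ p) (hq : 2 ≤ q) (r s n : ℤ) :
    Tendsto (atypicalValue p q r s n) (𝓝[≠] 0) (𝓝 ((r : ℂ) * s)) := by
  have hpi : (Real.pi : ℂ) ≠ 0 := by exact_mod_cast Real.pi_ne_zero
  have hne : ∀ x : ℂ, x ≠ 0 → I * Real.pi * x ≠ 0 := fun x hx =>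
    mul_ne_zero (mul_ne_zero I_ne_zero hpi) hx
  have h1 := sqrt_ne_zero hp hq
  have h2 := sqrt_ne_zero hq hp
  have h := tendsto_sin_mul_div_sin_mul (I * r * Real.pi * (Real.sqrt (2 * q / p) : ℂ))
    (I * s * Real.pi * (Real.sqrt (2 * p / q) : ℂ)) _ _ (hne _ h2) (hne _ h1)
  have hE : Tendsto (fun ε : ℂ => cexp ((Real.sqrt (2 * p * q) : ℂ) * Real.pi * n * ε))
      (𝓝[≠] 0) (𝓝 1) := by
    have : Continuous fun ε : ℂ => cexp ((Real.sqrt (2 * p * q) : ℂ) * Real.pi * n * ε) := by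
      fun_prop
    simpa using (this.tendsto 0).mono_left nhdsWithin_le_nhds
  convert! hE.mul h using 2
  · rw [atypicalValue, mul_div_assoc]
  · field_simp

theorem mem_region_of_pos {t : ℝ} (ht : 0 < t) : (t : ℂ) ∈ region p q :=
  ⟨(wall_nonpos _).trans_lt (by simpa using ht), by simpa using ht.ne'⟩

theorem wall_ofReal_le (hp : 2 ≤ p) (hq : 2 ≤ q) (t : ℝ) :
    wall p q (t : ℂ) ≤ -(1 / alpha p q) := by
  have ha := alpha_pos hp hq
  rw [wall, neg_le_neg_iff]
  refine le_csInf ⟨_, 1, ?_, rfl⟩ ?_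
  · intro h
    have h1 := Int.le_of_dvd one_pos h
    have h2 : 2 * 2 ≤ p * q := Nat.mul_le_mul hp hq
    omega
  · rintro x ⟨m, hm, rfl⟩
    have hm0 : m ≠ 0 := by rintro rfl; exact hm (dvd_zero _)
    have h1 : (1 : ℝ) ≤ |(m : ℝ)| := by exact_mod_cast Int.one_le_abs hm0
    rw [ofReal_im, sub_zero, abs_div, abs_of_pos ha]
    gcongr

theorem region_subset : region p q ⊆ {0}ᶜ := by
  rintro ε hε rfl
  exact hε.2 rfl

theorem tendsto_ofReal_region_right :
    Tendsto (fun t : ℝ => (t : ℂ)) (𝓝[>] 0) (𝓝[region p q] 0) := by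
  refine tendsto_nhdsWithin_iff.mpr ⟨?_, ?_⟩
  · simpa using (Complex.continuous_ofReal.tendsto 0).mono_left nhdsWithin_le_nhds
  · filter_upwards [self_mem_nhdsWithin] with t ht using mem_region_of_pos ht

theorem tendsto_ofReal_region_left (hp : 2 ≤ p) (hq : 2 ≤ q) :
    Tendsto (fun t : ℝ => (t : ℂ)) (𝓝[<] 0) (𝓝[region p q] 0) := by
  refine tendsto_nhdsWithin_iff.mpr ⟨?_, ?_⟩
  · simpa using (Complex.continuous_ofReal.tendsto 0).mono_left nhdsWithin_le_nhds
  · have ha : -(1 / alpha p q) < 0 := neg_neg_of_pos (one_div_pos.mpr (alpha_pos hp hq))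
    filter_upwards [Ioo_mem_nhdsLT ha] with t ht
    exact ⟨(wall_ofReal_le hp hq t).trans_lt (by simpa using ht.1), by simpa using ht.2.ne⟩

/-- If `qdim` is given by `v` on the region and `v` has a limit at `0`, so does `qdim`. -/
theorem tendsto_qdim (hp : 2 ≤ p) (hq : 2 ≤ q) {ch : ℂ → ℂ → ℂ} {v : ℂ → ℂ} {l : ℂ}
    (h : ∀ ε ∈ region p q, qdim p q ch ε = v ε) (hv : Tendsto v (𝓝[≠] 0) (𝓝 l)) :
    Tendsto (fun ε : ℂ => qdim p q ch ε) (𝓝[region p q] 0) (𝓝 l) ∧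
      Tendsto (fun t : ℝ => qdim p q ch (t : ℂ)) (𝓝[>] 0) (𝓝 l) ∧
      Tendsto (fun t : ℝ => qdim p q ch (t : ℂ)) (𝓝[<] 0) (𝓝 l) := by
  have h0 : Tendsto (fun ε : ℂ => qdim p q ch ε) (𝓝[region p q] 0) (𝓝 l) := by
    refine (hv.mono_left (nhdsWithin_mono 0 region_subset)).congr' ?_
    filter_upwards [self_mem_nhdsWithin] with ε hε using (h ε hε).symm
  exact ⟨h0, h0.comp tendsto_ofReal_region_right, h0.comp (tendsto_ofReal_region_left hp hq)⟩

theorem hasQdim_chF (hp : 2 ≤ p) (hq : 2 ≤ q) (lam : ℂ) {ε : ℂ} (hε : ε ∈ region p q) :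
    HasQdim p q (chF p q (lam + (alphaZero p q : ℂ) / 2)) ε (typicalValue p q lam ε) := by
  rw [← exp_div_limI hp hq]
  exact tendsto_div_of_fockSum (limI_ne_zero hp hq hε.2) (tendsto_chF lam ε)
    (tendsto_chVac hp hq hε)

theorem hasQdim_chI (hp : 2 ≤ p) (hq : 2 ≤ q) (r s n : ℤ) {ε : ℂ} (hε : ε ∈ region p q) :
    HasQdim p q (chI p q r s n) ε (atypicalValue p q r s n ε) := by
  rw [← limI_div hp hq r s n hε.2]
  exact tendsto_div_of_fockSum (limI_ne_zero hp hq hε.2) (tendsto_chI hp hq r s n hε)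
    (tendsto_chVac hp hq hε)

theorem tendsto_chF_div_chI (hp : 2 ≤ p) (hq : 2 ≤ q) (lam : ℂ) {ε : ℂ} (hε : ε ∈ region p q) :
    Tendsto (fun y : ℝ => chF p q (lam + (alphaZero p q : ℂ) / 2) ε (I * y)
      / chI p q 1 1 0 ε (I * y)) (𝓝[>] 0) (𝓝 (typicalValue p q lam ε)) := by
  rw [← exp_div_limI hp hq]
  exact tendsto_div_of_fockSum (limI_ne_zero hp hq hε.2) (tendsto_chF lam ε)
    (tendsto_chI hp hq 1 1 0 hε)

end Values
end Singlet

end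

theorem mainTheorem3 (p q : ℕ) (hp : 2 ≤ p) (hq : 2 ≤ q) (hpq : Nat.Coprime p q) :
    -- typical (more generally, standard) modules
    (∀ lam : ℂ,
      (∀ ε ∈ Singlet.region p q,
        Singlet.HasQdim p q (Singlet.chF p q (lam + (Singlet.alphaZero p q : ℂ) / 2)) ε
          (Singlet.typicalValue p q lam ε) ∧
        Singlet.qdim p q (Singlet.chF p q (lam + (Singlet.alphaZero p q : ℂ) / 2)) ε
          = Singlet.typicalValue p q lam ε ∧
        Tendsto (fun y : ℝ =>
            Singlet.chF p q (lam + (Singlet.alphaZero p q : ℂ) / 2) ε (-1 / (Complex.I * y))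
              / Singlet.chI p q 1 1 0 ε (-1 / (Complex.I * y)))
          atTop (𝓝 (Singlet.typicalValue p q lam ε))) ∧
      Tendsto (fun ε : ℂ =>
          Singlet.qdim p q (Singlet.chF p q (lam + (Singlet.alphaZero p q : ℂ) / 2)) ε)
        (𝓝[Singlet.region p q] 0) (𝓝 ((p : ℂ) * q)) ∧
      Tendsto (fun t : ℝ =>
          Singlet.qdim p q (Singlet.chF p q (lam + (Singlet.alphaZero p q : ℂ) / 2)) (t : ℂ))
        (𝓝[>] 0) (𝓝 ((p : ℂ) * q)) ∧
      Tendsto (fun t : ℝ =>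
          Singlet.qdim p q (Singlet.chF p q (lam + (Singlet.alphaZero p q : ℂ) / 2)) (t : ℂ))
        (𝓝[<] 0) (𝓝 ((p : ℂ) * q))) ∧
    -- atypical modules
    (∀ r s n : ℤ, 1 ≤ r → r ≤ p → 1 ≤ s → s ≤ q →
      (∀ ε ∈ Singlet.region p q,
        Singlet.HasQdim p q (Singlet.chI p q r s n) ε (Singlet.atypicalValue p q r s n ε) ∧
        Singlet.qdim p q (Singlet.chI p q r s n) ε
          = Singlet.sKernel p q r s n ε 0 / Singlet.sKernel p q 1 1 0 ε 0 ∧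
        Singlet.sKernel p q r s n ε 0 / Singlet.sKernel p q 1 1 0 ε 0
          = Singlet.atypicalValue p q r s n ε ∧
        Tendsto (fun y : ℝ =>
            Singlet.chI p q r s n ε (-1 / (Complex.I * y))
              / Singlet.chVac p q ε (-1 / (Complex.I * y)))
          atTop (𝓝 (Singlet.atypicalValue p q r s n ε))) ∧
      Tendsto (fun ε : ℂ => Singlet.qdim p q (Singlet.chI p q r s n) ε)
        (𝓝[Singlet.region p q] 0) (𝓝 ((r : ℂ) * s)) ∧
      Tendsto (fun t : ℝ => Singlet.qdim p q (Singlet.chI p q r s n) (t : ℂ))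
        (𝓝[>] 0) (𝓝 ((r : ℂ) * s)) ∧
      Tendsto (fun t : ℝ => Singlet.qdim p q (Singlet.chI p q r s n) (t : ℂ))
        (𝓝[<] 0) (𝓝 ((r : ℂ) * s))) := by
  have hF : ∀ lam : ℂ, ∀ ε ∈ Singlet.region p q, _ := fun lam ε hε =>
    (Singlet.hasQdim_chF hp hq lam hε).limUnder_eq
  have hI : ∀ r s n : ℤ, ∀ ε ∈ Singlet.region p q, _ := fun r s n ε hε =>
    (Singlet.hasQdim_chI hp hq r s n hε).limUnder_eq
  refine ⟨fun lam => ⟨fun ε hε => ⟨Singlet.hasQdim_chF hp hq lam hε, hF lam ε hε, ?_⟩,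
      Singlet.tendsto_qdim hp hq (hF lam) (Singlet.tendsto_typicalValue hp hq lam)⟩,
    fun r s n _ _ _ _ => ⟨fun ε hε => ⟨Singlet.hasQdim_chI hp hq r s n hε, ?_,
      Singlet.sKernel_div hp hq r s n hε.2, ?_⟩,
      Singlet.tendsto_qdim hp hq (hI r s n) (Singlet.tendsto_atypicalValue hp hq r s n)⟩⟩
  · exact Singlet.tendsto_modular (f := fun τ =>
      Singlet.chF p q (lam + (Singlet.alphaZero p q : ℂ) / 2) ε τ / Singlet.chI p q 1 1 0 ε τ)
      (Singlet.tendsto_chF_div_chI hp hq lam hε)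
  · rw [Singlet.sKernel_div hp hq r s n hε.2]
    exact hI r s n ε hε
  · exact Singlet.tendsto_modular (f := fun τ =>
      Singlet.chI p q r s n ε τ / Singlet.chVac p q ε τ) (Singlet.hasQdim_chI hp hq r s n hε)
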